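/- Let $(M,\omega)$ be a connected symplectic manifold without boundary (Hausdorff, second countable, finite-dimensional, not necessarily compact), and let $\mathrm{Ham}^c(M)$ be the group of compactly supported Hamiltonian symplectomorphisms, i.e. the time-one maps of isotopies starting at the identity and generated by compactly supported time-dependent Hamiltonians. A smooth path $\{\phi_t\}_{t\in I}$ in $\mathrm{Ham}^c(M)$ over an interval $I\subset\mathbf R$ has a generating Hamiltonian $\{H_t\}_{t\in I}$: a smooth family of functions on $M$, with supports in a common compact set for $t$ in any compact part of $I$, such that $\frac{d}{dt}\phi_t(x)=X_{H_t}(\phi_t(x))$, where $\omega(X_{H_t},\cdot)=dH_t$; each $H_t$ is unique up to an additive constant. For $I=[a,b]$ its Hofer length is $$\mathcal L(\{\phi_t\})=\int_a^b\bigl(\sup_M H_t-\inf_M H_t\bigr)\,dt .$$ Let $\mathcal P(g_0,g_1)$ be the space of smooth paths over $[a,b]$ from $g_0$ to $g_1$ in $\mathrm{Ham}^c(M)$, with the (strong) $C^\infty$ topology on the associated maps $[a,b]\times M\to M$. A path over $[a,b]$ is a local minimum of $\mathcal L$ if it minimizes $\mathcal L$ in some neighbourhood of itself in $\mathcal P(\phi_a,\phi_b)$.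 A path over $I$ is a geodesic if it is regular (for each $t\in I$ the tangent vector $\dot\phi_t$ is not identically zero) and each $s\in I$ has a closed neighbourhood $[a,b]$ in $I$, $a<b$, over which the path is a local minimum of $\mathcal L$. A fixed minimum (maximum) of the path over a set $N$ of times is a point of $M$ at which $H_t$ attains its minimum (maximum) over $M$ for every $t\in N$. **Theorem.** (i) Let $\{\phi_t\}_{t\in I}$ be a geodesic. Then each $s\in I$ has a neighbourhood $N_s$ in $I$ over which the path has at least one fixed minimum and at least one fixed maximum. (ii) Let $\gamma=\{\phi_t\}_{t\in[0,1]}$ be a smooth path in $\mathrm{Ham}^c(M)$ that has no fixed minimum over $[0,1]$ or has no fixed maximum over $[0,1]$. Then there is a deformation of $\gamma$ with fixed endpoints, i.e. a continuous family $\gamma_s$, $s\ge 0$, in $\mathcal P(\phi_0,\phi_1)$ with $\gamma_0=\gamma$, such that $\mathcal L(\gamma_s)<\mathcal L(\gamma)$ for all $s>0$. -/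

import Mathlib

open Set Filter Topology
open scoped Manifold ContDiff NNReal

noncomputable section

namespace Hofer

variable {E : Type*} [NormedAddCommGroup E] [NormedSpace ℝ E]
  {M : Type*} [TopologicalSpace M] [ChartedSpace E M]

/-- The coordinate expression, in the chart around `p`, of a field of alternating 2-forms `Ω`
on `M`, that is, its pull-back by the inverse of the chart (meaningful on the chart target). -/
def formInChart (Ω : (x : M) → (TangentSpace 𝓘(ℝ, E) x) [⋀^Fin 2]→L[ℝ] ℝ) (p : M) (y : E) :
    E [⋀^Fin 2]→L[ℝ] ℝ :=
  (Ω ((chartAt E p).symm y)).compContinuousLinearMap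
    (mfderiv 𝓘(ℝ, E) 𝓘(ℝ, E) (chartAt E p).symm y)

variable (E M) in
/-- A symplectic form on `M`: a smooth, closed, nondegenerate differential 2-form. -/
structure SymplecticForm where
  form : (x : M) → (TangentSpace 𝓘(ℝ, E) x) [⋀^Fin 2]→L[ℝ] ℝ
  smooth : ∀ p : M, ContDiffOn ℝ ∞ (formInChart form p) (chartAt E p).target
  closed : ∀ p : M, ∀ y ∈ (chartAt E p).target, extDeriv (formInChart form p) y = 0
  nondegenerate : ∀ (x : M) (v : TangentSpace 𝓘(ℝ, E) x), (∀ w, form x ![v, w] = 0) → v = 0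

/-- `X` is the Hamiltonian vector field of `f`: `Ω(X, ·) = df`. -/
def IsHamiltonianField (Ω : SymplecticForm E M) (f : M → ℝ)
    (X : (x : M) → TangentSpace 𝓘(ℝ, E) x) : Prop :=
  ∀ (x : M) (v : TangentSpace 𝓘(ℝ, E) x),
    Ω.form x ![X x, v] = mfderiv 𝓘(ℝ, E) 𝓘(ℝ, ℝ) f x v

variable (E M) in
/-- Diffeomorphisms of `M`. -/
abbrev Diffeo := M ≃ₘ^∞⟮𝓘(ℝ, E), 𝓘(ℝ, E)⟯ M

/-- `{φ_t}`, `t ∈ I`, is a smooth family of diffeomorphisms of `M` generated by the compactly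
supported Hamiltonian `{H_t}`, `t ∈ I`: `(d/dt) φ_t(x) = X_{H_t}(φ_t(x))`. The supports of the
`H_t` have to lie in one compact set as long as `t` stays in a compact part of `I`.
Values at times outside `I` are irrelevant. -/
structure IsHamiltonianIsotopy (Ω : SymplecticForm E M) (I : Set ℝ)
    (φ : ℝ → Diffeo E M) (H : ℝ → M → ℝ) : Prop where
  smooth_isotopy : ContMDiffOn (𝓘(ℝ, ℝ).prod 𝓘(ℝ, E)) 𝓘(ℝ, E) ∞
    (fun z : ℝ × M => φ z.1 z.2) (I ×ˢ univ)
  smooth_ham : ContMDiffOn (𝓘(ℝ, ℝ).prod 𝓘(ℝ, E)) 𝓘(ℝ, ℝ) ∞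
    (fun z : ℝ × M => H z.1 z.2) (I ×ˢ univ)
  compact_support : ∀ J ⊆ I, IsCompact J →
    ∃ K : Set M, IsCompact K ∧ ∀ t ∈ J, Function.support (H t) ⊆ K
  generates : ∀ t ∈ I, ∃ X : (x : M) → TangentSpace 𝓘(ℝ, E) x,
    IsHamiltonianField Ω (H t) X ∧
      ∀ x : M, HasMFDerivWithinAt 𝓘(ℝ, ℝ) 𝓘(ℝ, E) (fun τ : ℝ => φ τ x) I t
        (ContinuousLinearMap.toSpanSingleton ℝ (X (φ t x)))

/-- `Ham^c(M)`: the time-one maps of compactly supported Hamiltonian isotopies that start at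
the identity. -/
def HamC (Ω : SymplecticForm E M) : Set (Diffeo E M) :=
  {g | ∃ (φ : ℝ → Diffeo E M) (H : ℝ → M → ℝ),
    IsHamiltonianIsotopy Ω (Icc 0 1) φ H ∧ φ 0 = Diffeomorph.refl 𝓘(ℝ, E) M ∞ ∧ φ 1 = g}

/-- A smooth path `{φ_t}`, `t ∈ I`, in `Ham^c(M)`, together with its generating Hamiltonian
(which, on a connected `M`, is determined by the path up to adding to each `H_t` a constant). -/
structure HamPath (Ω : SymplecticForm E M) (I : Set ℝ) where
  φ : ℝ → Diffeo E M
  H : ℝ → M → ℝ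
  isotopy : IsHamiltonianIsotopy Ω I φ H
  mem : ∀ t ∈ I, φ t ∈ HamC Ω

/-- Hofer's norm: the total variation `sup f - inf f`. -/
def totVar (f : M → ℝ) : ℝ := (⨆ x, f x) - ⨅ x, f x

/-- The set of points where `f` attains its minimum. -/
def minset (f : M → ℝ) : Set M := {x | ∀ y, f x ≤ f y}

/-- The set of points where `f` attains its maximum. -/
def maxset (f : M → ℝ) : Set M := {x | ∀ y, f y ≤ f x}

namespace HamPath

variable {Ω : SymplecticForm E M} {I : Set ℝ}

/-- The restriction of a path to a smaller set of times. -/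
def restrict (γ : HamPath Ω I) {J : Set ℝ} (h : J ⊆ I) : HamPath Ω J where
  φ := γ.φ
  H := γ.H
  isotopy :=
    { smooth_isotopy := γ.isotopy.smooth_isotopy.mono (prod_mono h Subset.rfl)
      smooth_ham := γ.isotopy.smooth_ham.mono (prod_mono h Subset.rfl)
      compact_support := fun J' hJ' hc => γ.isotopy.compact_support J' (hJ'.trans h) hc
      generates := fun t ht => by
        obtain ⟨X, hX, hd⟩ := γ.isotopy.generates t (h ht)
        exact ⟨X, hX, fun x => (hd x).mono h⟩ }
  mem := fun t ht => γ.mem t (h ht)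

/-- The Hofer length of a path over `[a, b]`. -/
def length {a b : ℝ} (γ : HamPath Ω (Icc a b)) : ℝ := ∫ t in a..b, totVar (γ.H t)

/-- The map `(t, x) ↦ φ_t(x)` in the chart around `p` of the source and the chart around `q` of
the target. -/
def inCharts (γ : HamPath Ω I) (p q : M) (z : ℝ × E) : E :=
  chartAt E q (γ.φ z.1 ((chartAt E p).symm z.2))

/-- The paths `η` such that, for each `i` and at all points of `L i`, the map of `η` takes its
value in the chart around `q i` and its partial derivatives of order at most `n i`, in the chosen
charts, are `ε i`-close to those of `γ`. -/
def smoothBall (γ : HamPath Ω I) (L : ℕ → Set (ℝ × M)) (p q : ℕ → M) (n : ℕ → ℕ) (ε : ℕ → ℝ) :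
    Set (HamPath Ω I) :=
  {η | ∀ i, ∀ z ∈ L i, η.φ z.1 z.2 ∈ (chartAt E (q i)).source ∧
    ∀ k ≤ n i,
      ‖iteratedFDerivWithin ℝ k (η.inCharts (p i) (q i)) (I ×ˢ (chartAt E (p i)).target)
          (z.1, chartAt E (p i) z.2) -
        iteratedFDerivWithin ℝ k (γ.inCharts (p i) (q i)) (I ×ˢ (chartAt E (p i)).target)
          (z.1, chartAt E (p i) z.2)‖ < ε i}

/-- The (strong) `C^∞` topology on paths, through the associated maps `I × M → M`. For compact `I`
and `M` the locally finite families are finite, and this is the topology of uniform convergence of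
all derivatives. For noncompact `M` it is the fine one, in which convergence of a sequence entails
that all but finitely many of its terms agree outside a fixed compact set. -/
instance : TopologicalSpace (HamPath Ω I) :=
  TopologicalSpace.generateFrom
    {U | ∃ (γ : HamPath Ω I) (L : ℕ → Set (ℝ × M)) (p q : ℕ → M) (n : ℕ → ℕ) (ε : ℕ → ℝ),
      LocallyFinite L ∧
      (∀ i, IsCompact (L i) ∧ L i ⊆ I ×ˢ (chartAt E (p i)).source ∧ 0 < ε i ∧
        ∀ z ∈ L i, γ.φ z.1 z.2 ∈ (chartAt E (q i)).source) ∧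
      U = γ.smoothBall L p q n ε}

/-- The space `𝒫(g₀, g₁)` of paths over `[a, b]` from `g₀` to `g₁`. -/
def pathSpace (Ω : SymplecticForm E M) (a b : ℝ) (g₀ g₁ : Diffeo E M) :
    Set (HamPath Ω (Icc a b)) :=
  {γ | γ.φ a = g₀ ∧ γ.φ b = g₁}

/-- `γ` is a local minimum of the Hofer length among the paths with the same endpoints. -/
def IsLocallyMinimal {a b : ℝ} (γ : HamPath Ω (Icc a b)) : Prop :=
  IsLocalMinOn length (pathSpace Ω a b (γ.φ a) (γ.φ b)) γ

/-- `γ` is regular: its tangent vector (a vector field along `φ_t`) is nonzero at all times. -/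
def IsRegular (γ : HamPath Ω I) : Prop :=
  ∀ t ∈ I, ∃ x : M, mfderivWithin 𝓘(ℝ, ℝ) 𝓘(ℝ, E) (fun τ : ℝ => γ.φ τ x) I t ≠ 0

/-- `γ` is a geodesic: it is regular, and each `s ∈ I` has a closed neighbourhood `[a, b]` in `I`
over which `γ` is a local minimum of the Hofer length. -/
def IsGeodesic (γ : HamPath Ω I) : Prop :=
  γ.IsRegular ∧ ∀ s ∈ I, ∃ (a b : ℝ) (h : Icc a b ⊆ I), a < b ∧ s ∈ Icc a b ∧
    Icc a b ∈ 𝓝[I] s ∧ (γ.restrict h).IsLocallyMinimal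

/-- `γ` has at least one fixed minimum over the set of times `N`. -/
def HasFixedMin (γ : HamPath Ω I) (N : Set ℝ) : Prop := (⋂ t ∈ N, minset (γ.H t)).Nonempty

/-- `γ` has at least one fixed maximum over the set of times `N`. -/
def HasFixedMax (γ : HamPath Ω I) (N : Set ℝ) : Prop := (⋂ t ∈ N, maxset (γ.H t)).Nonempty

end HamPath

end Hofer

end

/-! Suppose that no point minimizes `H_t` for all `t`; replacing `H` by `-H` and reversing signs
handles maxima. Let `Ψ^i` be the flow of an autonomous Hamiltonian `ρ_i` supported in a chart, and
let `θ_i` vanish at both ends of the time interval. Composing `φ_t` with finitely many maps `Ψ^i_{s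
θ_i(t)}` keeps the endpoints. In coordinates moving with the deformation, which do not affect `sup -
inf`, the new Hamiltonian is `H_t + s R_{s,t}` with `R_{0,t} = G_t = ∑ θ_i'(t) ρ_i`
(`IsDeformation.compFlow`, `exists_isDeformation`). To first order in `s`, the variation of `H_t`
therefore grows by at most `s` times the largest `G_t(x) - G_t(y)` with `x` a maximum and `y` a
minimum of `H_t`. If this difference is never positive and is bounded below zero over some interval
of times, the length drops for small `s > 0` (`IsDeformation.eventually_totVar_le`,
`IsDeformation.eventually_length_lt`).

The constraint on `G` is that its time integral vanishes at each point, so raising the minima at one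
time must be paid for at another. The absence of a fixed minimum makes this free: each point near
the minima of `H_{t₀}` has a time near which it and its neighbours are not minima, and the
compensation is placed there. A finite cover, a subordinate partition of unity `ρ_i` and bump
functions `β₀`, `β_i` of mass one give `θ_i' = β₀ - β_i`
(`exists_variation_of_forall_notMem_minset`).

The deformation is smooth and has compact support, hence is continuous in the strong topology
(`continuous_hamPath`), which gives (ii). It also enters every neighbourhood of the path, so a local
minimum of the length has a fixed minimum and a fixed maximum over its whole interval, which gives
(i).

The flows come from compactly supported vector fields on the model space. Their smoothness follows
from the implicit function theorem for the integral equation in a space of curves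
(`IsFlow.contDiff`), and their symplecticity from closedness of the form (`IsFlow.preserves_form`).
-/

noncomputable section

namespace Hofer

/-! ### Smoothness of superposition operators -/

section Nemytskii

open scoped BoundedContinuousFunction

universe u

variable {K : Type*} [TopologicalSpace K] [CompactSpace K]

/-- A continuous function on a compact space, as a bounded continuous function. -/
def toBCF {E : Type*} [PseudoMetricSpace E] (f : K → E) (hf : Continuous f) : K →ᵇ E :=
  BoundedContinuousFunction.mkOfCompact ⟨f, hf⟩

@[simp] lemma toBCF_apply {E : Type*} [PseudoMetricSpace E] (f : K → E) (hf : Continuous f)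
    (k : K) : toBCF f hf k = f k := rfl

/-- Pointwise application of a continuous family of continuous linear maps, as a bounded operator. -/
def pointwiseApply {E F : Type*} [NormedAddCommGroup E] [NormedSpace ℝ E]
    [NormedAddCommGroup F] [NormedSpace ℝ F] :
    (K →ᵇ (E →L[ℝ] F)) →L[ℝ] (K →ᵇ E) →L[ℝ] (K →ᵇ F) :=
  LinearMap.mkContinuous₂
    (LinearMap.mk₂ ℝ (fun (A : K →ᵇ (E →L[ℝ] F)) (h : K →ᵇ E) =>
        (toBCF (fun k => A k (h k)) (A.continuous.clm_apply h.continuous) : K →ᵇ F))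
      (fun _ _ _ => by ext; simp) (fun _ _ _ => by ext; simp)
      (fun _ _ _ => by ext; simp) (fun _ _ _ => by ext; simp)) 1
    (fun A h => by
      refine (BoundedContinuousFunction.norm_le (by positivity)).2 fun k => ?_
      rw [one_mul]
      exact ((A k).le_opNorm _).trans (mul_le_mul (A.norm_coe_le_norm k) (h.norm_coe_le_norm k)
        (norm_nonneg _) (norm_nonneg A)))

lemma norm_pointwiseApply_le {E F : Type*} [NormedAddCommGroup E] [NormedSpace ℝ E]
    [NormedAddCommGroup F] [NormedSpace ℝ F] (A : K →ᵇ (E →L[ℝ] F)) :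
    ‖pointwiseApply A‖ ≤ ‖A‖ := by
  refine ContinuousLinearMap.opNorm_le_bound _ (norm_nonneg A) fun h => ?_
  refine (BoundedContinuousFunction.norm_le (by positivity)).2 fun k => ?_
  exact ((A k).le_opNorm _).trans (mul_le_mul (A.norm_coe_le_norm k) (h.norm_coe_le_norm k)
    (norm_nonneg _) (norm_nonneg A))

/-- The superposition operator `u ↦ V ∘ u`. -/
def postcomp {E F : Type*} [PseudoMetricSpace E] [PseudoMetricSpace F] (V : C(E, F)) (u : K →ᵇ E) :
    K →ᵇ F :=
  toBCF (fun k => V (u k)) (V.continuous.comp u.continuous)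

/-- The range of `u` is compact, so `V'` is uniformly continuous near it; the mean value inequality
then bounds the remainder uniformly in `k`. -/
lemma hasFDerivAt_postcomp {E F : Type*} [NormedAddCommGroup E] [NormedSpace ℝ E]
    [NormedAddCommGroup F] [NormedSpace ℝ F] (V : C(E, F)) (V' : C(E, E →L[ℝ] F))
    (h : ∀ x, HasFDerivAt V (V' x) x) (u : K →ᵇ E) :
    HasFDerivAt (fun w : K →ᵇ E => postcomp V w) (pointwiseApply (postcomp V' u)) u := by
  refine HasFDerivAt.of_isLittleO (Asymptotics.isLittleO_iff.2 fun c hc => ?_)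
  have hK : IsCompact (range u) := isCompact_range u.continuous
  have := hK.uniformContinuousAt_of_continuousAt V' (fun a _ => V'.continuous.continuousAt)
    (Metric.dist_mem_uniformity hc)
  obtain ⟨δ, hδ, hd⟩ := Metric.mem_uniformity_dist.1 this
  filter_upwards [Metric.ball_mem_nhds u hδ] with w hw
  refine (BoundedContinuousFunction.norm_le (by positivity)).2 fun k => ?_
  have hk : w k ∈ Metric.ball (u k) δ :=
    lt_of_le_of_lt (BoundedContinuousFunction.dist_coe_le_dist k) hw
  refine (Convex.norm_image_sub_le_of_norm_hasFDerivWithin_le' (f := V) (f' := V') (φ := V' (u k))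
    (s := Metric.ball (u k) δ)
    (fun x _ => (h x).hasFDerivWithinAt) (fun x hx => ?_) (convex_ball _ _)
    (Metric.mem_ball_self hδ) hk).trans
    (mul_le_mul_of_nonneg_left ((w - u).norm_coe_le_norm k) hc.le)
  have : dist (V' (u k)) (V' x) < c := @hd (u k) x (by rw [dist_comm]; exact hx) ⟨k, rfl⟩
  rw [← dist_eq_norm, dist_comm]
  exact this.le

/-- The derivative is a bounded linear operator applied to another superposition operator, that of
`fderiv ℝ V`. The induction thus changes the target space, which is why `F` is generalized and
shares the universe of `E`. -/
lemma contDiff_postcomp {E F : Type u} [NormedAddCommGroup E] [NormedSpace ℝ E]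
    [NormedAddCommGroup F] [NormedSpace ℝ F] (V : C(E, F)) (hV : ContDiff ℝ ∞ V) :
    ContDiff ℝ ∞ (fun w : K →ᵇ E => postcomp V w) := by
  refine contDiff_infty.2 fun n => ?_
  induction n generalizing F with
  | zero =>
    have h1 := contDiff_infty_iff_fderiv.1 hV
    exact contDiff_zero.2 (continuous_iff_continuousAt.2 fun u => (hasFDerivAt_postcomp V
      ⟨fderiv ℝ V, h1.2.continuous⟩ (fun x => (h1.1 x).hasFDerivAt) u).continuousAt)
  | succ n ih =>
    have h1 := contDiff_infty_iff_fderiv.1 hV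
    refine contDiff_succ_iff_hasFDerivAt.2 ⟨_, ?_, hasFDerivAt_postcomp V
      ⟨fderiv ℝ V, h1.2.continuous⟩ fun x => (h1.1 x).hasFDerivAt⟩
    exact pointwiseApply.contDiff.comp (ih ⟨fderiv ℝ V, h1.2.continuous⟩ h1.2)

end Nemytskii

/-! ### Integration operators on curves -/

section Volterra

open MeasureTheory
open scoped BoundedContinuousFunction

variable {E : Type*} [NormedAddCommGroup E] [NormedSpace ℝ E]

/-- The primitive `σ ↦ ∫₀^σ u` as a bounded operator on `C([0, 1], E)`. -/
def primitiveCLM : (Icc (0 : ℝ) 1 →ᵇ E) →L[ℝ] (Icc (0 : ℝ) 1 →ᵇ E) :=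
  LinearMap.mkContinuous
    { toFun := fun u => toBCF (fun σ => ∫ s in (0 : ℝ)..σ, IccExtend zero_le_one u s)
        ((intervalIntegral.continuous_primitive
          (fun _ _ => (u.continuous.Icc_extend').intervalIntegrable _ _) 0).comp
          continuous_subtype_val)
      map_add' := fun u w => by
        ext σ
        exact intervalIntegral.integral_add (u.continuous.Icc_extend'.intervalIntegrable _ _)
          (w.continuous.Icc_extend'.intervalIntegrable _ _)
      map_smul' := fun c u => by
        ext σ
        exact intervalIntegral.integral_smul c _ }
    1 (fun u => by
      refine (BoundedContinuousFunction.norm_le (by positivity)).2 fun σ => ?_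
      have := intervalIntegral.norm_integral_le_of_norm_le_const (a := 0) (b := (σ : ℝ))
        (f := IccExtend zero_le_one u) (C := ‖u‖) (fun s _ => u.norm_coe_le_norm _)
      refine this.trans ?_
      rw [mul_comm]
      refine mul_le_mul_of_nonneg_right ?_ (norm_nonneg _)
      rw [sub_zero, abs_of_nonneg σ.2.1]
      exact σ.2.2)

lemma primitiveCLM_apply (u : Icc (0 : ℝ) 1 →ᵇ E) (σ : Icc (0 : ℝ) 1) :
    primitiveCLM u σ = ∫ s in (0 : ℝ)..σ, IccExtend zero_le_one u s := rfl

lemma norm_primitiveCLM_le : ‖(primitiveCLM : (Icc (0 : ℝ) 1 →ᵇ E) →L[ℝ] _)‖ ≤ 1 :=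
  LinearMap.mkContinuous_norm_le _ zero_le_one _

/-- Constant functions, as a bounded operator. -/
def constCLM : E →L[ℝ] (Icc (0 : ℝ) 1 →ᵇ E) :=
  LinearMap.mkContinuous
    { toFun := fun x => toBCF (fun _ => x) continuous_const
      map_add' := fun _ _ => rfl
      map_smul' := fun _ _ => rfl } 1 (fun x => by
        refine (BoundedContinuousFunction.norm_le (by positivity)).2 fun k => ?_
        rw [one_mul]
        exact le_rfl)

@[simp] lemma constCLM_apply (x : E) (σ : Icc (0 : ℝ) 1) : constCLM x σ = x := rfl

end Volterra

/-! ### Global flows of bounded Lipschitz vector fields -/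

section Flow

variable {E : Type*} [NormedAddCommGroup E] [NormedSpace ℝ E]

/-- `Φ` is the global flow of the vector field `V`. -/
structure IsFlow (V : E → E) (Φ : ℝ → E → E) : Prop where
  zero : ∀ x, Φ 0 x = x
  deriv : ∀ τ x, HasDerivAt (fun σ => Φ σ x) (V (Φ τ x)) τ

/-- A solution over `[-a, a]` stays within distance `B * a` of its start, so Picard–Lindelöf applies
for every `a`; the solutions then combine into a global integral curve. -/
lemma exists_isFlow [CompleteSpace E] {V : E → E} (hV : ContDiff ℝ ∞ V) {B C : ℝ≥0}
    (hB : ∀ x, ‖V x‖ ≤ B) (hC : LipschitzWith C V) : ∃ Φ, IsFlow V Φ := by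
  have key : ∀ x : E, ∃ γ : ℝ → E, γ 0 = x ∧ IsMIntegralCurve (I := 𝓘(ℝ, E)) γ V := by
    intro x
    refine (exists_isMIntegralCurve_iff_exists_isMIntegralCurveOn_Ioo (I := 𝓘(ℝ, E)) (v := V)
      ?_ x).2 fun a => ?_
    · exact contMDiff_vectorSpace_iff_contDiff.2 (hV.of_le (by simp))
    · by_cases ha : a < 0
      · exact ⟨fun _ => x, rfl, fun t ht => by have := ht.1.trans ht.2; linarith⟩
      push Not at ha
      lift a to ℝ≥0 using ha
      have hp : IsPicardLindelof (fun _ => V) (tmin := -(a : ℝ)) (tmax := a)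
          ⟨0, by simp⟩ x (B * a) 0 B C :=
        IsPicardLindelof.of_time_independent (fun y _ => hB y) hC.lipschitzOnWith (by simp)
      obtain ⟨α, h0, h1⟩ := hp.exists_eq_forall_mem_Icc_hasDerivWithinAt₀
      refine ⟨α, h0, fun t ht => ?_⟩
      have := (h1 t (Ioo_subset_Icc_self ht)).mono Ioo_subset_Icc_self
      exact hasMFDerivWithinAt_iff_hasFDerivWithinAt.2 this.hasFDerivWithinAt
  choose γ h0 h1 using key
  refine ⟨fun τ x => γ x τ, h0, fun τ x => ?_⟩
  have h2 : HasFDerivAt (γ x) ((1 : ℝ →L[ℝ] ℝ).smulRight (V (γ x τ))) τ :=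
    hasMFDerivAt_iff_hasFDerivAt.1 (h1 x τ)
  simpa using h2.hasDerivAt

namespace IsFlow

variable {V : E → E} {Φ : ℝ → E → E} {C : ℝ≥0}

lemma unique (hΦ : IsFlow V Φ) (hC : LipschitzWith C V) {c : ℝ → E} {x : E} (h0 : c 0 = x)
    (hc : ∀ τ, HasDerivAt c (V (c τ)) τ) (τ : ℝ) : c τ = Φ τ x := by
  have := ODE_solution_unique_univ (v := fun _ => V) (s := fun _ => univ) (K := C) (t₀ := 0)
    (f := c) (g := fun τ => Φ τ x) (fun _ => hC.lipschitzOnWith) (fun t => ⟨hc t, trivial⟩)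
    (fun t => ⟨hΦ.deriv t x, trivial⟩) (by rw [h0, hΦ.zero])
  exact congrFun this τ

lemma add (hΦ : IsFlow V Φ) (hC : LipschitzWith C V) (σ τ : ℝ) (x : E) :
    Φ (σ + τ) x = Φ σ (Φ τ x) := by
  refine hΦ.unique hC (c := fun σ => Φ (σ + τ) x) (by simp) (fun σ => ?_) σ
  exact (hΦ.deriv (σ + τ) x).comp_add_const σ τ

lemma eq_self (hΦ : IsFlow V Φ) (hC : LipschitzWith C V) {x : E} (hx : V x = 0) (τ : ℝ) :
    Φ τ x = x :=
  (hΦ.unique hC (c := fun _ => x) rfl (fun τ => by simpa [hx] using hasDerivAt_const τ x) τ).symm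

lemma neg_apply (hΦ : IsFlow V Φ) (hC : LipschitzWith C V) (τ : ℝ) (x : E) :
    Φ (-τ) (Φ τ x) = x := by
  rw [← hΦ.add hC, neg_add_cancel, hΦ.zero]

end IsFlow

end Flow

/-! ### Smooth dependence of flows on time and initial point -/

section SmoothFlow

open scoped BoundedContinuousFunction

universe u

variable {E : Type u} [NormedAddCommGroup E] [NormedSpace ℝ E]

/-- The integral equation `u(σ) = x + τ ∫₀^σ V(u)`. -/
def flowEquation (V : C(E, E)) (z : (ℝ × E) × (Icc (0 : ℝ) 1 →ᵇ E)) : (Icc (0 : ℝ) 1 →ᵇ E) :=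
  z.2 - constCLM z.1.2 - z.1.1 • primitiveCLM (postcomp V z.2)

lemma contDiff_flowEquation (V : C(E, E)) (hV : ContDiff ℝ ∞ V) :
    ContDiff ℝ ∞ (flowEquation V) := by
  have h1 : ContDiff ℝ ∞ (fun z : (ℝ × E) × (Icc (0 : ℝ) 1 →ᵇ E) => primitiveCLM (postcomp V z.2)) :=
    primitiveCLM.contDiff.comp ((contDiff_postcomp V hV).comp contDiff_snd)
  have h2 : ContDiff ℝ ∞ (fun z : (ℝ × E) × (Icc (0 : ℝ) 1 →ᵇ E) =>
      constCLM z.1.2) :=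
    (ContinuousLinearMap.contDiff _).comp (contDiff_snd.comp contDiff_fst)
  exact (contDiff_snd.sub h2).sub ((contDiff_fst.comp contDiff_fst).smul h1)

lemma isInvertible_of_isUnit {F : Type*} [NormedAddCommGroup F] [NormedSpace ℝ F] {A : F →L[ℝ] F}
    (hA : IsUnit A) : A.IsInvertible := by
  obtain ⟨w, rfl⟩ := hA
  exact ⟨ContinuousLinearEquiv.unitsEquiv ℝ F w, rfl⟩

lemma IsFlow.comp_mul {V : E → E} {Φ : ℝ → E → E} (hΦ : IsFlow V Φ) (τ : ℝ) (x : E) (σ : ℝ) :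
    HasDerivAt (fun σ => Φ (τ * σ) x) (τ • V (Φ (τ * σ) x)) σ := by
  have := (hΦ.deriv (τ * σ) x).scomp σ ((hasDerivAt_id σ).const_mul τ)
  simpa [Function.comp_def] using this

lemma IsFlow.continuous_right {V : E → E} {Φ : ℝ → E → E} (hΦ : IsFlow V Φ) (x : E) :
    Continuous fun τ => Φ τ x :=
  continuous_iff_continuousAt.2 fun τ => (hΦ.deriv τ x).continuousAt

/-- Rescaling time to `[0, 1]` makes `τ` a parameter, so that all trajectories lie in one Banach
space. -/
lemma IsFlow.flowEquation_eq_zero [CompleteSpace E] {V : C(E, E)} {Φ : ℝ → E → E} (hΦ : IsFlow V Φ) (τ : ℝ) (x : E) :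
    flowEquation V ((τ, x), toBCF (fun σ => Φ (τ * σ) x) ((hΦ.continuous_right x).comp
      (continuous_const.mul continuous_subtype_val))) = 0 := by
  ext σ
  simp only [flowEquation, BoundedContinuousFunction.coe_sub, BoundedContinuousFunction.coe_smul,
    primitiveCLM_apply, Pi.sub_apply, BoundedContinuousFunction.coe_zero, Pi.zero_apply,
    toBCF_apply, constCLM_apply]
  have h1 := intervalIntegral.integral_eq_sub_of_hasDerivAt (a := 0) (b := σ)
    (fun s _ => hΦ.comp_mul τ x s) (Continuous.intervalIntegrable (by
      exact continuous_const.smul (V.continuous.comp ((hΦ.continuous_right x).comp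
        (continuous_const.mul continuous_id)))) _ _)
  rw [intervalIntegral.integral_smul, mul_zero, hΦ.zero] at h1
  rw [sub_eq_zero, ← h1]
  congr 1
  refine intervalIntegral.integral_congr fun s hs => ?_
  rw [uIcc_of_le σ.2.1] at hs
  rw [IccExtend_of_mem _ _ ⟨hs.1, hs.2.trans σ.2.2⟩]
  rfl

lemma IsFlow.eq_of_flowEquation_eq_zero [CompleteSpace E] {V : C(E, E)} {Φ : ℝ → E → E} (hΦ : IsFlow V Φ) {C : ℝ≥0}
    (hC : LipschitzWith C V) {τ : ℝ} {x : E} {w : (Icc (0 : ℝ) 1 →ᵇ E)}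
    (hw : flowEquation V ((τ, x), w) = 0) : w ⟨1, by simp⟩ = Φ τ x := by
  have h1 : ∀ σ : Icc (0 : ℝ) 1, w σ =
      x + τ • ∫ s in (0 : ℝ)..σ, V (IccExtend zero_le_one w s) := by
    intro σ
    have := congrArg (fun f : (Icc (0 : ℝ) 1 →ᵇ E) => f σ) hw
    simp only [flowEquation, BoundedContinuousFunction.coe_sub, Pi.sub_apply,
      BoundedContinuousFunction.coe_zero, Pi.zero_apply, sub_sub, sub_eq_zero] at this
    exact this
  have hcont : Continuous (fun s => V (IccExtend zero_le_one w s)) :=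
    V.continuous.comp w.continuous.Icc_extend'
  have h2 : ∀ s ∈ Icc (0 : ℝ) 1, IccExtend zero_le_one w s =
      x + τ • ∫ r in (0 : ℝ)..s, V (IccExtend zero_le_one w r) := by
    intro s hs
    rw [IccExtend_of_mem _ _ hs]
    exact h1 ⟨s, hs⟩
  have h3 : EqOn (fun s => x + τ • ∫ r in (0 : ℝ)..s, V (IccExtend zero_le_one w r))
      (fun s => Φ (τ * s) x) (Icc 0 1) := by
    have hd : ∀ s, HasDerivAt (fun s => x + τ • ∫ r in (0 : ℝ)..s, V (IccExtend zero_le_one w r))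
        (τ • V (IccExtend zero_le_one w s)) s := fun s =>
      ((intervalIntegral.integral_hasDerivAt_right (hcont.intervalIntegrable _ _)
        (hcont.stronglyMeasurableAtFilter _ _) hcont.continuousAt).const_smul τ).const_add x
    have hL : LipschitzWith (‖τ‖₊ * C) (fun y => τ • V y) := by
      exact (lipschitzWith_smul τ).comp hC
    refine ODE_solution_unique (v := fun _ y => τ • V y) (K := ‖τ‖₊ * C) (fun _ => hL)
      (fun s _ => (hd s).continuousAt.continuousWithinAt) (fun s hs => ?_)
      (fun s _ => (hΦ.comp_mul τ x s).continuousAt.continuousWithinAt)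
      (fun s _ => (hΦ.comp_mul τ x s).hasDerivWithinAt) ?_
    · rw [← h2 s (Ico_subset_Icc_self hs)]
      exact (hd s).hasDerivWithinAt
    · simp [hΦ.zero]
  have h4 := h3 (x := 1) (by simp)
  rw [h1]
  refine h4.trans ?_
  simp

/-- The partial derivative of the integral equation in the curve is `1 - T` with `‖T‖ ≤ |τ| C < 1`,
invertible by the Neumann series. The implicit function theorem gives a curve depending smoothly on
`(τ, x)`, and its value at `1` is the flow. -/
lemma IsFlow.contDiffAt_of_small [CompleteSpace E] {V : E → E} {Φ : ℝ → E → E} (hΦ : IsFlow V Φ)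
    (hV : ContDiff ℝ ∞ V) {C : ℝ≥0} (hC : LipschitzWith C V) {τ : ℝ} (hτ : |τ| * C < 1) (x : E) :
    ContDiffAt ℝ ∞ (fun z : ℝ × E => Φ z.1 z.2) (τ, x) := by
  let W : C(E, E) := ⟨V, hV.continuous⟩
  let u₀ : (Icc (0 : ℝ) 1 →ᵇ E) := toBCF (fun σ => Φ (τ * σ) x)
    ((hΦ.continuous_right x).comp (continuous_const.mul continuous_subtype_val))
  have hz : flowEquation W ((τ, x), u₀) = 0 := IsFlow.flowEquation_eq_zero (V := W) hΦ τ x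
  have hcd : ContDiffAt ℝ ∞ (flowEquation W) ((τ, x), u₀) :=
    (contDiff_flowEquation W hV).contDiffAt
  let W' : C(E, E →L[ℝ] E) := ⟨fderiv ℝ V, (contDiff_infty_iff_fderiv.1 hV).2.continuous⟩
  let T : (Icc (0 : ℝ) 1 →ᵇ E) →L[ℝ] (Icc (0 : ℝ) 1 →ᵇ E) :=
    τ • primitiveCLM ∘L pointwiseApply (postcomp W' u₀)
  have hT : ‖T‖ < 1 := by
    have h1 : ‖postcomp W' u₀‖ ≤ C := (BoundedContinuousFunction.norm_le C.2).2 fun k =>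
      norm_fderiv_le_of_lipschitz ℝ hC
    calc ‖T‖ ≤ |τ| * (‖(primitiveCLM : (Icc (0 : ℝ) 1 →ᵇ E) →L[ℝ] _)‖ *
          ‖pointwiseApply (postcomp W' u₀)‖) := by
          rw [norm_smul, Real.norm_eq_abs]
          exact mul_le_mul_of_nonneg_left (ContinuousLinearMap.opNorm_comp_le _ _) (abs_nonneg _)
      _ ≤ |τ| * (1 * C) := by
          refine mul_le_mul_of_nonneg_left ?_ (abs_nonneg _)
          exact mul_le_mul norm_primitiveCLM_le ((norm_pointwiseApply_le _).trans h1)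
            (norm_nonneg _) zero_le_one
      _ < 1 := by rwa [one_mul]
  have hinv : (fderiv ℝ (flowEquation W) ((τ, x), u₀) ∘L
      .inr ℝ (ℝ × E) (Icc (0 : ℝ) 1 →ᵇ E)).IsInvertible := by
    have h1 : fderiv ℝ (flowEquation W) ((τ, x), u₀) ∘L .inr ℝ (ℝ × E) (Icc (0 : ℝ) 1 →ᵇ E) =
        1 - T := by
      have h2 : HasFDerivAt (fun w => flowEquation W ((τ, x), w))
          (fderiv ℝ (flowEquation W) ((τ, x), u₀) ∘L .inr ℝ (ℝ × E) (Icc (0 : ℝ) 1 →ᵇ E)) u₀ :=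
        (hcd.differentiableAt (by simp)).hasFDerivAt.comp u₀ (hasFDerivAt_prodMk_right (τ, x) u₀)
      have h3 : HasFDerivAt (fun w => flowEquation W ((τ, x), w)) (1 - T) u₀ := by
        have h4 := (primitiveCLM.hasFDerivAt.comp u₀ (hasFDerivAt_postcomp W W'
          (fun y => ((contDiff_infty_iff_fderiv.1 hV).1 y).hasFDerivAt) u₀)).const_smul τ
        exact ((hasFDerivAt_id u₀).sub_const (constCLM x)).sub h4
      exact h2.unique h3
    rw [h1]
    exact isInvertible_of_isUnit ⟨Units.oneSub T hT, rfl⟩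
  have hψ := hcd.contDiffAt_implicitFunction (by simp) hinv
  have hev := hcd.eventually_apply_implicitFunction (by simp) hinv
  have hfin := ((BoundedContinuousFunction.evalCLM ℝ (⟨1, by simp⟩ : Icc (0 : ℝ) 1)).contDiff (n := ∞)
    |>.contDiffAt).comp (τ, x) hψ
  refine hfin.congr_of_eventuallyEq ?_
  filter_upwards [hev] with p hp
  rw [hz] at hp
  exact (IsFlow.eq_of_flowEquation_eq_zero (V := W) hΦ hC hp).symm

/-- The group law removes the restriction on time: `Φ τ` is an iterate of `Φ (τ / n)`, and near time
`τ` the flow is the small-time flow after `Φ τ`. -/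
lemma IsFlow.contDiff [CompleteSpace E] {V : E → E} {Φ : ℝ → E → E} (hΦ : IsFlow V Φ)
    (hV : ContDiff ℝ ∞ V) {C : ℝ≥0} (hC : LipschitzWith C V) :
    ContDiff ℝ ∞ (fun z : ℝ × E => Φ z.1 z.2) := by
  have hsmall : ∀ τ : ℝ, |τ| * C < 1 → ContDiff ℝ ∞ (Φ τ) := fun τ hτ =>
    contDiff_iff_contDiffAt.2 fun x => (hΦ.contDiffAt_of_small hV hC hτ x).comp x
      (f := fun x => (τ, x)) (contDiffAt_const.prodMk contDiffAt_id)
  have hmul : ∀ (τ : ℝ) (n : ℕ), ContDiff ℝ ∞ (Φ τ) → ContDiff ℝ ∞ (Φ (n * τ)) := by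
    intro τ n h
    induction n with
    | zero => simpa [funext hΦ.zero] using (contDiff_fun_id : ContDiff ℝ ∞ (fun x : E => x))
    | succ n ih =>
      have : Φ ((n + 1 : ℕ) * τ) = Φ τ ∘ Φ (n * τ) := by
        ext x
        rw [Function.comp_apply, ← hΦ.add hC]
        congr 1
        push_cast
        ring
      rw [this]
      exact h.comp ih
  have hall : ∀ τ : ℝ, ContDiff ℝ ∞ (Φ τ) := by
    intro τ
    obtain ⟨n, hn⟩ := exists_nat_gt (|τ| * C)
    have hn0 : (0 : ℝ) < n := lt_of_le_of_lt (by positivity) hn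
    have h1 := hmul (τ / n) n (hsmall _ (by
      rw [abs_div, abs_of_pos hn0, div_mul_eq_mul_div, div_lt_one hn0]
      exact hn))
    rwa [mul_div_cancel₀ _ hn0.ne'] at h1
  refine contDiff_iff_contDiffAt.2 fun ⟨τ, x⟩ => ?_
  have h1 : (fun z : ℝ × E => Φ z.1 z.2) =
      (fun z : ℝ × E => Φ z.1 z.2) ∘ (fun z : ℝ × E => (z.1 - τ, Φ τ z.2)) := by
    ext z
    rw [Function.comp_apply, ← hΦ.add hC, sub_add_cancel]
  rw [h1]
  refine ContDiffAt.comp (τ, x) ?_ ?_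
  · simp only [sub_self]
    exact hΦ.contDiffAt_of_small hV hC (by simp) _
  · exact (contDiffAt_fst.sub contDiffAt_const).prodMk ((hall τ).contDiffAt.comp _ contDiffAt_snd)

end SmoothFlow

/-! ### Invariance of a closed 2-form under Hamiltonian flows in a linear chart -/

section

variable {E : Type*} [NormedAddCommGroup E] [NormedSpace ℝ E]

lemma hasFDerivAt_right_of_uncurry {Φ : ℝ → E → E}
    (hs : ContDiff ℝ ∞ (fun z : ℝ × E => Φ z.1 z.2)) (τ : ℝ) (y : E) :
    HasFDerivAt (Φ τ) (fderiv ℝ (fun z : ℝ × E => Φ z.1 z.2) (τ, y) ∘L .inr ℝ ℝ E) y :=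
  (hs.differentiable (by simp) (τ, y)).hasFDerivAt.comp y (hasFDerivAt_prodMk_right τ y)

/-- The derivative of a flow solves the variational equation. -/
lemma IsFlow.hasDerivAt_fderiv {V : E → E} {Φ : ℝ → E → E} (hΦ : IsFlow V Φ)
    (hs : ContDiff ℝ ∞ (fun z : ℝ × E => Φ z.1 z.2)) (hV : ContDiff ℝ ∞ V) (τ : ℝ) (y u : E) :
    HasDerivAt (fun τ => fderiv ℝ (Φ τ) y u) (fderiv ℝ V (Φ τ y) (fderiv ℝ (Φ τ) y u)) τ := by
  set F : ℝ × E → E := fun z => Φ z.1 z.2 with hF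
  have hF1 : Differentiable ℝ F := hs.differentiable (by simp)
  have hF2 : Differentiable ℝ (fderiv ℝ F) :=
    (contDiff_infty_iff_fderiv.1 hs).2.differentiable (by simp)
  have h1 : ∀ τ, fderiv ℝ (Φ τ) y u = fderiv ℝ F (τ, y) (0, u) := fun τ => by
    rw [(hasFDerivAt_right_of_uncurry hs τ y).fderiv]
    simp [hF]
  have h2 : ∀ z : ℝ × E, fderiv ℝ F z (1, 0) = V (F z) := fun z => by
    have h3 : HasDerivAt (fun σ : ℝ => F (σ, z.2)) (fderiv ℝ F z (1, 0)) z.1 := by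
      have := (hF1 z).hasFDerivAt.comp_hasDerivAt z.1
        (f := fun σ : ℝ => (σ, z.2)) ((hasDerivAt_id z.1).prodMk (hasDerivAt_const z.1 z.2))
      exact this
    exact h3.unique (hΦ.deriv z.1 z.2)
  have h4 : HasDerivAt (fun τ : ℝ => fderiv ℝ F (τ, y) (0, u))
      (fderiv ℝ (fderiv ℝ F) (τ, y) (1, 0) (0, u)) τ := by
    have h5 := (hF2 (τ, y)).hasFDerivAt.comp_hasDerivAt τ
      (f := fun σ : ℝ => (σ, y)) ((hasDerivAt_id τ).prodMk (hasDerivAt_const τ y))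
    simpa using h5.clm_apply (hasDerivAt_const τ ((0, u) : ℝ × E))
  -- Symmetry of the second derivative exchanges differentiation in time and in the initial point.
  have h6 : fderiv ℝ (fderiv ℝ F) (τ, y) (1, 0) (0, u) =
      fderiv ℝ (fderiv ℝ F) (τ, y) (0, u) (1, 0) :=
    second_derivative_symmetric (fun z => (hF1 z).hasFDerivAt) (hF2 (τ, y)).hasFDerivAt _ _
  have h7 : fderiv ℝ (fderiv ℝ F) (τ, y) (0, u) (1, 0) =
      fderiv ℝ V (Φ τ y) (fderiv ℝ F (τ, y) (0, u)) := by
    have h8 : HasFDerivAt (fun z => fderiv ℝ F z (1, 0))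
        ((ContinuousLinearMap.apply ℝ E ((1, 0) : ℝ × E)) ∘L fderiv ℝ (fderiv ℝ F) (τ, y)) (τ, y) :=
      (ContinuousLinearMap.apply ℝ E ((1, 0) : ℝ × E)).hasFDerivAt.comp (τ, y)
        (hF2 (τ, y)).hasFDerivAt
    have h9 : HasFDerivAt (fun z => fderiv ℝ F z (1, 0))
        (fderiv ℝ V (F (τ, y)) ∘L fderiv ℝ F (τ, y)) (τ, y) := by
      rw [funext h2]
      exact (hV.differentiable (by simp) _).hasFDerivAt.comp (τ, y) (hF1 (τ, y)).hasFDerivAt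
    exact congrArg (fun A : ℝ × E →L[ℝ] E => A (0, u)) (h8.unique h9)
  rw [funext h1, h1, ← h7, ← h6]
  exact h4

/-- A Hamiltonian flow preserves the symplectic form, in a linear chart. -/
lemma IsFlow.preserves_form {V : E → E} {Φ : ℝ → E → E} (hΦ : IsFlow V Φ)
    (hs : ContDiff ℝ ∞ (fun z : ℝ × E => Φ z.1 z.2)) (hV : ContDiff ℝ ∞ V)
    {U : Set E} (hU : IsOpen U) (hUΦ : ∀ τ, ∀ y ∈ U, Φ τ y ∈ U)
    {B : E → E →L[ℝ] E →L[ℝ] ℝ} (hB : ContDiffOn ℝ ∞ B U)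
    (halt : ∀ y ∈ U, ∀ v w, B y v w = -B y w v)
    (hclosed : ∀ y ∈ U, ∀ a b c,
      fderiv ℝ B y a b c - fderiv ℝ B y b a c + fderiv ℝ B y c a b = 0)
    {r : E → ℝ} (hr : ContDiffOn ℝ ∞ r U) (hVr : ∀ y ∈ U, ∀ w, B y (V y) w = fderiv ℝ r y w)
    (τ : ℝ) {y : E} (hy : y ∈ U) (u v : E) :
    B (Φ τ y) (fderiv ℝ (Φ τ) y u) (fderiv ℝ (Φ τ) y v) = B y u v := by
  have hBd : ∀ z ∈ U, HasFDerivAt B (fderiv ℝ B z) z := fun z hz =>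
    ((hB.contDiffAt (hU.mem_nhds hz)).differentiableAt (by simp)).hasFDerivAt
  have hVd : ∀ z, HasFDerivAt V (fderiv ℝ V z) z := fun z =>
    (hV.differentiable (by simp) z).hasFDerivAt
  have hr1 : ∀ z ∈ U, HasFDerivAt r (fderiv ℝ r z) z := fun z hz =>
    ((hr.contDiffAt (hU.mem_nhds hz)).differentiableAt (by simp)).hasFDerivAt
  have hr2 : ∀ z ∈ U, HasFDerivAt (fderiv ℝ r) (fderiv ℝ (fderiv ℝ r) z) z := fun z hz =>
    (((hr.contDiffAt (hU.mem_nhds hz)).fderiv_right (m := ∞) (by simp)).differentiableAt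
      (by simp)).hasFDerivAt
  have hsymm : ∀ z ∈ U, ∀ a b, fderiv ℝ (fderiv ℝ r) z a b = fderiv ℝ (fderiv ℝ r) z b a := by
    intro z hz a b
    refine second_derivative_symmetric_of_eventually (f := r) ?_ (hr2 z hz) a b
    filter_upwards [hU.mem_nhds hz] with x hx using hr1 x hx
  have hdiff : ∀ z ∈ U, ∀ a w, fderiv ℝ B z a (V z) w + B z (fderiv ℝ V z a) w =
      fderiv ℝ (fderiv ℝ r) z a w := by
    intro z hz a w
    have h1 := ((hBd z hz).clm_apply (hVd z)).clm_apply (hasFDerivAt_const w z)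
    have h2 := (hr2 z hz).clm_apply (hasFDerivAt_const w z)
    have h3 := h1.congr_of_eventuallyEq (f₁ := fun y => fderiv ℝ r y w) (by
      filter_upwards [hU.mem_nhds hz] with x hx using (hVr x hx w).symm)
    have h4 := congrArg (fun A : E →L[ℝ] ℝ => A a) (h3.unique h2)
    simp at h4
    rw [← h4, add_comm]
  -- Cartan's formula in coordinates: closedness reduces the Lie derivative of `B` along `V` to the
  -- exterior derivative of `B(V, ·) = dr`, which vanishes by symmetry of the Hessian of `r`.
  have hconst : ∀ σ, HasDerivAt
      (fun σ => B (Φ σ y) (fderiv ℝ (Φ σ) y u) (fderiv ℝ (Φ σ) y v)) 0 σ := by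
    intro σ
    have hz := hUΦ σ y hy
    have hBc : HasDerivAt (fun σ => B (Φ σ y)) (fderiv ℝ B (Φ σ y) (V (Φ σ y))) σ :=
      HasFDerivAt.comp_hasDerivAt (l := B) (f := fun σ => Φ σ y) σ (hBd _ hz) (hΦ.deriv σ y)
    have ha := hΦ.hasDerivAt_fderiv hs hV σ y u
    have hb := hΦ.hasDerivAt_fderiv hs hV σ y v
    refine ((hBc.clm_apply ha).clm_apply hb).congr_deriv ?_
    generalize fderiv ℝ (Φ σ) y u = a
    generalize fderiv ℝ (Φ σ) y v = b
    have e1 := hdiff _ hz a b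
    have e2 := hdiff _ hz b a
    have e3 := hsymm _ hz a b
    have e4 := hclosed _ hz (V (Φ σ y)) a b
    have e5 := halt _ hz a (fderiv ℝ V (Φ σ y) b)
    simp only [_root_.add_apply]
    linarith
  have h0 := is_const_of_deriv_eq_zero (fun σ => (hconst σ).differentiableAt)
    (fun σ => (hconst σ).deriv) τ 0
  refine h0.trans ?_
  rw [show Φ 0 = id from funext hΦ.zero]
  simp

lemma update_pair_zero {F : Type*} (a b x : F) : Function.update ![a, b] 0 x = ![x, b] := by
  ext i; fin_cases i <;> rfl

lemma update_pair_one {F : Type*} (a b x : F) : Function.update ![a, b] 1 x = ![a, x] := by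
  ext i; fin_cases i <;> rfl

/-- An alternating 2-form as a bilinear form. -/
def toBilin [FiniteDimensional ℝ E] (α : E [⋀^Fin 2]→L[ℝ] ℝ) : E →L[ℝ] E →L[ℝ] ℝ :=
  LinearMap.toContinuousLinearMap
    (LinearMap.toContinuousLinearMap.toLinearMap ∘ₗ
      LinearMap.mk₂ ℝ (fun v w => α ![v, w])
        (fun a b c => by
          have := α.map_update_add ![a, c] 0 a b
          rwa [update_pair_zero, update_pair_zero, update_pair_zero] at this)
        (fun k a c => by
          have := α.map_update_smul ![a, c] 0 k a
          rwa [update_pair_zero, update_pair_zero] at this)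
        (fun a b c => by
          have := α.map_update_add ![a, b] 1 b c
          rwa [update_pair_one, update_pair_one, update_pair_one] at this)
        (fun k a c => by
          have := α.map_update_smul ![a, c] 1 k c
          rwa [update_pair_one, update_pair_one] at this))

@[simp] lemma toBilin_apply [FiniteDimensional ℝ E] (α : E [⋀^Fin 2]→L[ℝ] ℝ) (v w : E) :
    toBilin α v w = α ![v, w] := rfl

lemma form_swap {F : Type*} [AddCommGroup F] [Module ℝ F] [TopologicalSpace F]
    (α : F [⋀^Fin 2]→L[ℝ] ℝ) (v w : F) : α ![v, w] = -α ![w, v] := by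
  have := α.toAlternatingMap.map_swap ![w, v] (show (0 : Fin 2) ≠ 1 by simp)
  rw [show ![w, v] ∘ Equiv.swap (0 : Fin 2) 1 = ![v, w] by ext i; fin_cases i <;> simp] at this
  exact this

lemma contDiffOn_toBilin [FiniteDimensional ℝ E] {α : E → E [⋀^Fin 2]→L[ℝ] ℝ} {U : Set E}
    (hα : ContDiffOn ℝ ∞ α U) : ContDiffOn ℝ ∞ (fun y => toBilin (α y)) U := by
  refine contDiffOn_clm_apply.2 fun v => contDiffOn_clm_apply.2 fun w => ?_
  exact (ContinuousAlternatingMap.apply ℝ E ℝ ![v, w]).contDiff.comp_contDiffOn hα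

lemma closed_toBilin [FiniteDimensional ℝ E] {α : E → E [⋀^Fin 2]→L[ℝ] ℝ} {U : Set E}
    (hU : IsOpen U) (hα : ContDiffOn ℝ ∞ α U) {y : E} (hy : y ∈ U) (h : extDeriv α y = 0)
    (a b c : E) :
    fderiv ℝ (fun y => toBilin (α y)) y a b c - fderiv ℝ (fun y => toBilin (α y)) y b a c +
      fderiv ℝ (fun y => toBilin (α y)) y c a b = 0 := by
  have hd : DifferentiableAt ℝ α y := (hα.contDiffAt (hU.mem_nhds hy)).differentiableAt (by simp)
  have hBd : HasFDerivAt (fun y => toBilin (α y)) (fderiv ℝ (fun y => toBilin (α y)) y) y :=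
    (((contDiffOn_toBilin hα).contDiffAt (hU.mem_nhds hy)).differentiableAt (by simp)).hasFDerivAt
  have key : ∀ v w x : E, fderiv ℝ (fun y => α y ![v, w]) y x =
      fderiv ℝ (fun y => toBilin (α y)) y x v w := by
    intro v w x
    have h1 := (hBd.clm_apply (hasFDerivAt_const v y)).clm_apply (hasFDerivAt_const w y)
    have h2 := h1.fderiv
    simp only [toBilin_apply] at h2
    rw [h2]
    simp
  have h1 := extDeriv_apply hd ![a, b, c]
  rw [h] at h1
  have r0 : (0 : Fin 3).removeNth ![a, b, c] = ![b, c] := by ext i; fin_cases i <;> rfl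
  have r1 : (1 : Fin 3).removeNth ![a, b, c] = ![a, c] := by ext i; fin_cases i <;> rfl
  have r2 : (2 : Fin 3).removeNth ![a, b, c] = ![a, b] := by ext i; fin_cases i <;> rfl
  rw [Fin.sum_univ_three, r0, r1, r2, key, key, key] at h1
  simp at h1
  linarith

end

/-! ### Hamiltonian vector fields on `M` and in charts -/

section

lemma form_sub_left {F : Type*} [AddCommGroup F] [Module ℝ F] [TopologicalSpace F]
    (α : F [⋀^Fin 2]→L[ℝ] ℝ) (a b w : F) : α ![a - b, w] = α ![a, w] - α ![b, w] := by
  have := α.map_update_sub ![a, w] 0 a b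
  rwa [update_pair_zero, update_pair_zero, update_pair_zero] at this

variable {E : Type*} [NormedAddCommGroup E] [NormedSpace ℝ E]
  {M : Type*} [TopologicalSpace M] [ChartedSpace E M]

lemma SymplecticForm.eq_of_forall (Ω : SymplecticForm E M) {x : M} {a b : TangentSpace 𝓘(ℝ, E) x}
    (h : ∀ w, Ω.form x ![a, w] = Ω.form x ![b, w]) : a = b := by
  refine sub_eq_zero.1 (Ω.nondegenerate x _ fun w => ?_)
  rw [form_sub_left, h w, sub_self]

/-- The symplectic form at a point, as a bilinear form on the model space. -/
def SymplecticForm.bilin [FiniteDimensional ℝ E] (Ω : SymplecticForm E M) (x : M) :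
    E →L[ℝ] E →L[ℝ] ℝ :=
  toBilin (E := E) (Ω.form x)

lemma SymplecticForm.eq_of_bilin [FiniteDimensional ℝ E] (Ω : SymplecticForm E M) {x : M} {a b : E}
    (h : ∀ w, Ω.bilin x a w = Ω.bilin x b w) : a = b :=
  Ω.eq_of_forall (x := x) h

/-- The differential of a function, as a linear form on the model space. -/
def dfun (f : M → ℝ) (x : M) : E →L[ℝ] ℝ := mfderiv 𝓘(ℝ, E) 𝓘(ℝ, ℝ) f x

/-- The derivative of a map, between model spaces. -/
def dmap (f : M → M) (x : M) : E →L[ℝ] E := mfderiv 𝓘(ℝ, E) 𝓘(ℝ, E) f x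

/-- The derivative of a chart. -/
def dchart (p x : M) : E →L[ℝ] E := mfderiv 𝓘(ℝ, E) 𝓘(ℝ, E) (chartAt E p) x

/-- The derivative of the inverse of a chart. -/
def dsymm (p : M) (y : E) : E →L[ℝ] E := mfderiv 𝓘(ℝ, E) 𝓘(ℝ, E) (chartAt E p).symm y

lemma isInvertible_of_injective [FiniteDimensional ℝ E] {B : E →L[ℝ] E →L[ℝ] ℝ}
    (hB : ∀ v, (∀ w, B v w = 0) → v = 0) : B.IsInvertible := by
  have hinj : Function.Injective B.toLinearMap :=
    (injective_iff_map_eq_zero _).2 fun v hv => hB v fun w => by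
      have : B v = 0 := hv
      simp [this]
  have hd : Module.finrank ℝ E = Module.finrank ℝ (E →L[ℝ] ℝ) := by
    rw [← (LinearMap.toContinuousLinearMap (𝕜 := ℝ) (E := E) (F' := ℝ)).finrank_eq]
    exact (Subspace.dual_finrank_eq (K := ℝ) (V := E)).symm
  let e := LinearMap.linearEquivOfInjective B.toLinearMap hinj hd
  exact ⟨e.toContinuousLinearEquiv, by ext v; rfl⟩

lemma SymplecticForm.exists_hamiltonianField [FiniteDimensional ℝ E] (Ω : SymplecticForm E M)
    (f : M → ℝ) : ∃ X, IsHamiltonianField Ω f X := by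
  have : ∀ x : M, ∃ v : E, ∀ w : E, Ω.bilin x v w = dfun f x w := by
    intro x
    obtain ⟨e, he⟩ := isInvertible_of_injective (B := Ω.bilin x) (Ω.nondegenerate x)
    refine ⟨e.symm (dfun f x), fun w => ?_⟩
    rw [← he]
    have : (e : E →L[ℝ] E →L[ℝ] ℝ) (e.symm (dfun f x)) = dfun f x := e.apply_symm_apply _
    rw [this]
  choose X hX using this
  exact ⟨X, hX⟩

lemma IsHamiltonianField.eq_zero {Ω : SymplecticForm E M} {f : M → ℝ}
    {X : (x : M) → TangentSpace 𝓘(ℝ, E) x} (hX : IsHamiltonianField Ω f X) {x : M}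
    (hx : x ∉ tsupport f) : X x = 0 := by
  refine Ω.nondegenerate x _ fun w => ?_
  have h : f =ᶠ[𝓝 x] fun _ => (0 : ℝ) := notMem_tsupport_iff_eventuallyEq.1 hx
  rw [hX, h.mfderiv_eq, mfderiv_const]
  rfl

lemma toBilin_formInChart [FiniteDimensional ℝ E] (Ω : SymplecticForm E M) (p : M) (y v w : E) :
    toBilin (formInChart Ω.form p y) v w =
      Ω.bilin ((chartAt E p).symm y) (dsymm p y v) (dsymm p y w) := by
  have h : (fun i => dsymm p y (![v, w] i)) = ![dsymm p y v, dsymm p y w] := by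
    ext i
    fin_cases i <;> rfl
  exact congrArg (fun m : Fin 2 → E =>
    (show E [⋀^Fin 2]→L[ℝ] ℝ from Ω.form ((chartAt E p).symm y)) m) h

variable [IsManifold 𝓘(ℝ, E) ∞ M]

lemma isManifold_one : IsManifold 𝓘(ℝ, E) 1 M := IsManifold.of_le (n := ∞) (by simp)

lemma dchart_dsymm (p : M) {y : E} (hy : y ∈ (chartAt E p).target) (v : E) :
    dchart p ((chartAt E p).symm y) (dsymm p y v) = v := by
  have := isManifold_one (E := E) (M := M)
  have h := (mdifferentiable_chart (I := 𝓘(ℝ, E)) p).comp_symm_deriv hy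
  exact congrArg (fun A : E →L[ℝ] E => A v) h

lemma dsymm_dchart (p : M) {x : M} (hx : x ∈ (chartAt E p).source) (v : E) :
    dsymm p (chartAt E p x) (dchart p x v) = v := by
  have := isManifold_one (E := E) (M := M)
  have h := (mdifferentiable_chart (I := 𝓘(ℝ, E)) p).symm_comp_deriv hx
  exact congrArg (fun A : E →L[ℝ] E => A v) h

lemma contDiffOn_comp_chart_symm {F : Type*} [NormedAddCommGroup F] [NormedSpace ℝ F] {f : M → F}
    (hf : ContMDiff 𝓘(ℝ, E) 𝓘(ℝ, F) ∞ f) (p : M) :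
    ContDiffOn ℝ ∞ (fun y => f ((chartAt E p).symm y)) (chartAt E p).target :=
  contMDiffOn_iff_contDiffOn.1 (hf.comp_contMDiffOn contMDiffOn_chart_symm)

lemma fderiv_comp_chart_symm {f : M → ℝ} (hf : ContMDiff 𝓘(ℝ, E) 𝓘(ℝ, ℝ) ∞ f) (p : M) {y : E}
    (hy : y ∈ (chartAt E p).target) (w : E) :
    fderiv ℝ (fun y => f ((chartAt E p).symm y)) y w =
      dfun f ((chartAt E p).symm y) (dsymm p y w) := by
  have := isManifold_one (E := E) (M := M)
  have h := mfderiv_comp y (hf.mdifferentiable (by simp) ((chartAt E p).symm y))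
    ((mdifferentiable_chart (I := 𝓘(ℝ, E)) p).mdifferentiableAt_symm hy)
  rw [← mfderiv_eq_fderiv]
  exact congrArg (fun A : E →L[ℝ] ℝ => A w) h

/-- The Hamiltonian vector field of a function supported in a chart domain, in the chart. -/
lemma exists_chart_field [FiniteDimensional ℝ E] (Ω : SymplecticForm E M) (p : M) {ρ : M → ℝ}
    (hρ : ContMDiff 𝓘(ℝ, E) 𝓘(ℝ, ℝ) ∞ ρ) (hc : HasCompactSupport ρ)
    (hs : tsupport ρ ⊆ (chartAt E p).source) :
    ∃ V : E → E, ContDiff ℝ ∞ V ∧ HasCompactSupport V ∧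
      (∀ y, y ∉ chartAt E p '' tsupport ρ → V y = 0) ∧
      ∀ y ∈ (chartAt E p).target, ∀ w, toBilin (formInChart Ω.form p y) (V y) w =
        fderiv ℝ (fun y => ρ ((chartAt E p).symm y)) y w := by
  classical
  set e := chartAt E p with he
  set g : E → ℝ := fun y => ρ (e.symm y) with hg
  set B : E → E →L[ℝ] E →L[ℝ] ℝ := fun y => toBilin (formInChart Ω.form p y) with hB
  have hgs : ContDiffOn ℝ ∞ g e.target := contDiffOn_comp_chart_symm hρ p
  have hBs : ContDiffOn ℝ ∞ B e.target := contDiffOn_toBilin (Ω.smooth p)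
  have hinv : ∀ y ∈ e.target, (B y).IsInvertible := by
    intro y hy
    refine isInvertible_of_injective fun v hv => ?_
    have h0 : dsymm p y v = 0 := by
      refine Ω.nondegenerate (e.symm y) _ fun (w : E) => ?_
      have h1 := hv (dchart p (e.symm y) w)
      simp only [hB] at h1
      have h2 := dsymm_dchart p (e.map_target hy) w
      rw [← he, e.right_inv hy] at h2
      rw [toBilin_formInChart, h2] at h1
      exact h1
    have h3 := dchart_dsymm p hy v
    rw [← h3, h0, map_zero]
  have hcomp : IsCompact (e '' tsupport ρ) :=
    hc.isCompact.image_of_continuousOn (e.continuousOn.mono hs)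
  -- Extension by zero is smooth because the field already vanishes off the image of `tsupport ρ`,
  -- which is compact and hence closed in all of `E`.
  let V : E → E := fun y => if y ∈ e.target then (B y).inverse (fderiv ℝ g y) else 0
  have hV0 : ∀ y, y ∉ e '' tsupport ρ → V y = 0 := by
    intro y hy
    by_cases hyt : y ∈ e.target
    · have hgz : g =ᶠ[𝓝 y] fun _ => (0 : ℝ) := by
        filter_upwards [e.open_target.mem_nhds hyt, hcomp.isClosed.isOpen_compl.mem_nhds hy]
          with z hz hz'
        refine image_eq_zero_of_notMem_tsupport (f := ρ) fun h => hz' ⟨e.symm z, h, e.right_inv hz⟩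
      simp only [V, if_pos hyt]
      rw [hgz.fderiv_eq]
      simp
    · simp only [V, if_neg hyt]
  have hVs : ContDiff ℝ ∞ V := by
    refine contDiff_iff_contDiffAt.2 fun y => ?_
    by_cases hyt : y ∈ e.target
    · have h1 : ContDiffAt ℝ ∞ (fun y => (B y).inverse (fderiv ℝ g y)) y := by
        refine ContDiffAt.clm_apply ?_ ?_
        · obtain ⟨f, hf⟩ := hinv y hyt
          exact ContDiffAt.comp y (g := ContinuousLinearMap.inverse) (hf ▸ contDiffAt_map_inverse f)
            (hBs.contDiffAt (e.open_target.mem_nhds hyt))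
        · exact (hgs.contDiffAt (e.open_target.mem_nhds hyt)).fderiv_right (by simp)
      refine h1.congr_of_eventuallyEq ?_
      filter_upwards [e.open_target.mem_nhds hyt] with z hz
      simp only [V, if_pos hz]
    · refine (contDiffAt_const (c := (0 : E))).congr_of_eventuallyEq ?_
      have hy : y ∉ e '' tsupport ρ := by
        rintro ⟨x, hx, rfl⟩
        exact hyt (e.map_source (hs hx))
      filter_upwards [hcomp.isClosed.isOpen_compl.mem_nhds hy] with z hz using hV0 z hz
  refine ⟨V, hVs, HasCompactSupport.of_support_subset_isCompact hcomp fun y hy => ?_, hV0, ?_⟩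
  · by_contra h
    exact hy (hV0 y h)
  · intro y hy w
    obtain ⟨f, hf⟩ := hinv y hy
    simp only [V, if_pos hy]
    change B y ((B y).inverse _) w = _
    rw [← hf, ContinuousLinearMap.inverse_equiv]
    have : (f : E →L[ℝ] E →L[ℝ] ℝ) (f.symm (fderiv ℝ g y)) = fderiv ℝ g y := f.apply_symm_apply _
    exact congrArg (fun A : E →L[ℝ] ℝ => A w) this

end

/-! ### Flows on `M` of Hamiltonians supported in a chart -/

section

variable {E : Type*} [NormedAddCommGroup E] [NormedSpace ℝ E]
  {M : Type*} [TopologicalSpace M] [ChartedSpace E M]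

/-- `Ψ` is the flow of the autonomous Hamiltonian `ρ`, as a family of symplectomorphisms of `M`
that are the identity off the support of `ρ`. -/
structure IsHamiltonianFlow [FiniteDimensional ℝ E] (Ω : SymplecticForm E M) (ρ : M → ℝ)
    (Ψ : ℝ → Diffeo E M) : Prop where
  smooth : ContMDiff (𝓘(ℝ, ℝ).prod 𝓘(ℝ, E)) 𝓘(ℝ, E) ∞ (fun z : ℝ × M => Ψ z.1 z.2)
  zero : ∀ x, Ψ 0 x = x
  neg_apply : ∀ τ x, Ψ (-τ) (Ψ τ x) = x
  eq_self : ∀ τ, ∀ x ∉ tsupport ρ, Ψ τ x = x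
  generates : ∃ X : (x : M) → TangentSpace 𝓘(ℝ, E) x, IsHamiltonianField Ω ρ X ∧
    ∀ τ x, HasMFDerivAt 𝓘(ℝ, ℝ) 𝓘(ℝ, E) (fun σ => Ψ σ x) τ
      (ContinuousLinearMap.toSpanSingleton ℝ (X (Ψ τ x)))
  symplectic : ∀ τ x u v, Ω.bilin (Ψ τ x) (dmap (Ψ τ) x u) (dmap (Ψ τ) x v) = Ω.bilin x u v

lemma contMDiff_uncurry_of_contDiff {F : Type*} [NormedAddCommGroup F] [NormedSpace ℝ F]
    {f : ℝ × E → F} (hf : ContDiff ℝ ∞ f) :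
    ContMDiff (𝓘(ℝ, ℝ).prod 𝓘(ℝ, E)) 𝓘(ℝ, F) ∞ f := by
  rw [← modelWithCornersSelf_prod, chartedSpaceSelf_prod]
  exact hf.contMDiff

variable [IsManifold 𝓘(ℝ, E) ∞ M]

lemma hasMFDerivAt_chart_symm (p : M) {y : E} (hy : y ∈ (chartAt E p).target) :
    HasMFDerivAt 𝓘(ℝ, E) 𝓘(ℝ, E) (chartAt E p).symm y (dsymm (E := E) p y) := by
  have := isManifold_one (E := E) (M := M)
  exact ((mdifferentiable_chart (I := 𝓘(ℝ, E)) p).mdifferentiableAt_symm hy).hasMFDerivAt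

lemma hasMFDerivAt_chart (p : M) {x : M} (hx : x ∈ (chartAt E p).source) :
    HasMFDerivAt 𝓘(ℝ, E) 𝓘(ℝ, E) (chartAt E p) x (dchart (E := E) p x) := by
  have := isManifold_one (E := E) (M := M)
  exact ((mdifferentiable_chart (I := 𝓘(ℝ, E)) p).mdifferentiableAt hx).hasMFDerivAt

/-- The support lies in one chart, so the flow can be built in the model space, transported to the
chart domain and extended by the identity. -/
theorem exists_isHamiltonianFlow [FiniteDimensional ℝ E] (Ω : SymplecticForm E M) (p : M)
    {ρ : M → ℝ} (hρ : ContMDiff 𝓘(ℝ, E) 𝓘(ℝ, ℝ) ∞ ρ) (hc : HasCompactSupport ρ)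
    (hs : tsupport ρ ⊆ (chartAt E p).source) : ∃ Ψ, IsHamiltonianFlow Ω ρ Ψ := by
  classical
  obtain ⟨V, hV, hVc, hV0, hVr⟩ := exists_chart_field Ω p hρ hc hs
  set e := chartAt E p with he
  obtain ⟨b, hb⟩ := hVc.exists_bound_of_continuous hV.continuous
  obtain ⟨C, hC⟩ := hV.lipschitzWith_of_hasCompactSupport hVc (by simp)
  obtain ⟨Φ, hΦ⟩ := exists_isFlow hV (B := b.toNNReal)
    (fun x => (hb x).trans (Real.le_coe_toNNReal b)) hC
  have hΦs := hΦ.contDiff hV hC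
  have hfix : ∀ τ, ∀ y ∉ e '' tsupport ρ, Φ τ y = y := fun τ y hy => hΦ.eq_self hC (hV0 y hy) τ
  -- A point outside the chart target is at rest, so flowing back from it cannot lead into the
  -- target.
  have hmaps : ∀ τ, ∀ y ∈ e.target, Φ τ y ∈ e.target := by
    intro τ y hy
    by_contra h
    have h1 : Φ τ y ∉ e '' tsupport ρ := by
      rintro ⟨x, hx, hxy⟩
      exact h (hxy ▸ e.map_source (hs hx))
    have h2 := hΦ.neg_apply hC τ y
    rw [hfix (-τ) _ h1] at h2
    exact h (by rwa [h2])
  let F : ℝ → M → M := fun τ x => if x ∈ e.source then e.symm (Φ τ (e x)) else x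
  have hFs : ∀ τ, ∀ x ∈ e.source, F τ x = e.symm (Φ τ (e x)) := fun τ x hx => if_pos hx
  have hFm : ∀ τ, ∀ x ∈ e.source, F τ x ∈ e.source := fun τ x hx => by
    rw [hFs τ x hx]
    exact e.map_target (hmaps _ _ (e.map_source hx))
  have hFe : ∀ τ, ∀ x ∈ e.source, e (F τ x) = Φ τ (e x) := fun τ x hx => by
    rw [hFs τ x hx, e.right_inv (hmaps _ _ (e.map_source hx))]
  have hFo : ∀ τ, ∀ x ∉ tsupport ρ, F τ x = x := by
    intro τ x hx
    by_cases hxs : x ∈ e.source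
    · rw [hFs τ x hxs, hfix τ, e.left_inv hxs]
      rintro ⟨z, hz, hzx⟩
      exact hx (e.injOn (hs hz) hxs hzx ▸ hz)
    · exact if_neg hxs
  have hFneg : ∀ τ x, F (-τ) (F τ x) = x := by
    intro τ x
    by_cases hxs : x ∈ e.source
    · rw [hFs _ _ (hFm τ x hxs), hFe τ x hxs, hΦ.neg_apply hC, e.left_inv hxs]
    · have hx : x ∉ tsupport ρ := fun h => hxs (hs h)
      rw [hFo τ x hx, hFo _ x hx]
  have hsmooth : ContMDiff (𝓘(ℝ, ℝ).prod 𝓘(ℝ, E)) 𝓘(ℝ, E) ∞ (fun z : ℝ × M => F z.1 z.2) := by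
    rintro ⟨τ, x⟩
    by_cases hxs : x ∈ e.source
    · have h1 : ContMDiffAt (𝓘(ℝ, ℝ).prod 𝓘(ℝ, E)) (𝓘(ℝ, ℝ).prod 𝓘(ℝ, E)) ∞
          (fun z : ℝ × M => (z.1, e z.2)) (τ, x) := by
        refine contMDiffAt_fst.prodMk ?_
        exact ContMDiffAt.comp (τ, x) (contMDiffOn_chart.contMDiffAt (e.open_source.mem_nhds hxs))
          contMDiffAt_snd
      have h2 := (contMDiff_uncurry_of_contDiff hΦs).contMDiffAt.comp (τ, x) h1
      have h3 : ContMDiffAt 𝓘(ℝ, E) 𝓘(ℝ, E) ∞ e.symm (Φ τ (e x)) :=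
        contMDiffOn_chart_symm.contMDiffAt
          (e.open_target.mem_nhds (hmaps τ _ (e.map_source hxs)))
      refine (ContMDiffAt.comp (τ, x) h3 h2).congr_of_eventuallyEq ?_
      filter_upwards [continuousAt_snd.preimage_mem_nhds (e.open_source.mem_nhds hxs)] with z hz
      exact hFs _ _ hz
    · refine contMDiffAt_snd.congr_of_eventuallyEq ?_
      have hx : x ∈ (tsupport ρ)ᶜ := fun h => hxs (hs h)
      filter_upwards [continuousAt_snd.preimage_mem_nhds
        ((isClosed_tsupport ρ).isOpen_compl.mem_nhds hx)] with z hz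
      exact hFo _ _ hz
  have hsm : ∀ τ, ContMDiff 𝓘(ℝ, E) 𝓘(ℝ, E) ∞ (F τ) := fun τ =>
    hsmooth.comp (contMDiff_const.prodMk contMDiff_id)
  let Ψ : ℝ → Diffeo E M := fun τ =>
    { toFun := F τ
      invFun := F (-τ)
      left_inv := hFneg τ
      right_inv := fun x => by simpa using hFneg (-τ) x
      contMDiff_toFun := hsm τ
      contMDiff_invFun := hsm (-τ) }
  have hΨ : ∀ τ, ⇑(Ψ τ) = F τ := fun τ => rfl
  obtain ⟨X, hX⟩ := Ω.exists_hamiltonianField ρ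
  have hXe : ∀ y ∈ e.target, X (e.symm y) = dsymm p y (V y) := by
    intro y hy
    refine Ω.eq_of_bilin (x := e.symm y) fun w => ?_
    have h1 := hVr y hy (dchart p (e.symm y) w)
    rw [toBilin_formInChart, fderiv_comp_chart_symm hρ p hy] at h1
    have h2 : dsymm p y (dchart p (e.symm y) w) = w := by
      have := dsymm_dchart p (e.map_target hy) w
      rwa [← he, e.right_inv hy] at this
    rw [h2] at h1
    exact (hX (e.symm y) w).trans h1.symm
  have hgen : ∀ τ x, HasMFDerivAt 𝓘(ℝ, ℝ) 𝓘(ℝ, E) (fun σ => F σ x) τ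
      (ContinuousLinearMap.toSpanSingleton ℝ (X (F τ x))) := by
    intro τ x
    by_cases hxs : x ∈ e.source
    · have hy := hmaps τ _ (e.map_source hxs)
      have h1 : HasMFDerivAt 𝓘(ℝ, ℝ) 𝓘(ℝ, E) (fun σ => Φ σ (e x)) τ
          (ContinuousLinearMap.toSpanSingleton ℝ (V (Φ τ (e x)))) :=
        (hΦ.deriv τ (e x)).hasFDerivAt.hasMFDerivAt
      have h2 := (hasMFDerivAt_chart_symm p hy).comp τ h1
      have h3 : (fun σ => F σ x) = e.symm ∘ fun σ => Φ σ (e x) := funext fun σ => hFs σ x hxs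
      have h4 : dsymm p (Φ τ (e x)) ∘L ContinuousLinearMap.toSpanSingleton ℝ (V (Φ τ (e x))) =
          ContinuousLinearMap.toSpanSingleton ℝ (X (F τ x) : E) := by
        ext
        rw [hFs τ x hxs, hXe _ hy, ContinuousLinearMap.comp_apply,
          ContinuousLinearMap.toSpanSingleton_apply, one_smul]
        exact (one_smul ℝ _).symm
      rw [h3]
      exact h2.congr_mfderiv h4
    · have hx : x ∉ tsupport ρ := fun h => hxs (hs h)
      have h3 : (fun σ => F σ x) = fun _ => x := funext fun σ => hFo σ x hx
      have h4 : (0 : ℝ →L[ℝ] E) = ContinuousLinearMap.toSpanSingleton ℝ (X (F τ x) : E) := by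
        have h5 : X (F τ x) = 0 := by
          rw [hFo τ x hx]
          exact hX.eq_zero hx
        rw [h5]
        ext
        exact (smul_zero (1 : ℝ)).symm
      rw [h3]
      exact (hasMFDerivAt_const x τ).congr_mfderiv h4
  have hsymp : ∀ τ x u v, Ω.bilin (F τ x) (dmap (F τ) x u) (dmap (F τ) x v) = Ω.bilin x u v := by
    intro τ x u v
    by_cases hxs : x ∈ e.source
    · have hex := e.map_source hxs
      have h1 : dmap (F τ) x = dsymm p (Φ τ (e x)) ∘L (fderiv ℝ (Φ τ) (e x) ∘L dchart p x) := by
        have h2 : F τ =ᶠ[𝓝 x] e.symm ∘ (Φ τ ∘ e) := by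
          filter_upwards [e.open_source.mem_nhds hxs] with z hz using hFs τ z hz
        have h3 : HasMFDerivAt 𝓘(ℝ, E) 𝓘(ℝ, E) (Φ τ) (e x) (fderiv ℝ (Φ τ) (e x)) :=
          (hasFDerivAt_right_of_uncurry hΦs τ (e x)).differentiableAt.hasFDerivAt.hasMFDerivAt
        exact (((hasMFDerivAt_chart_symm p (hmaps τ _ hex)).comp x
          (h3.comp x (hasMFDerivAt_chart p hxs))).congr_of_eventuallyEq h2).mfderiv
      have h4 := hΦ.preserves_form hΦs hV e.open_target hmaps
        (B := fun y => toBilin (formInChart Ω.form p y)) (contDiffOn_toBilin (Ω.smooth p))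
        (fun y _ v w => form_swap (formInChart Ω.form p y) v w)
        (fun y hy => closed_toBilin e.open_target (Ω.smooth p) hy (Ω.closed p y hy))
        (contDiffOn_comp_chart_symm hρ p) hVr τ hex (dchart p x u) (dchart p x v)
      simp only [toBilin_formInChart] at h4
      rw [← he, dsymm_dchart p hxs, dsymm_dchart p hxs, e.left_inv hxs] at h4
      rw [h1, hFs τ x hxs]
      exact h4
    · have hx : x ∈ (tsupport ρ)ᶜ := fun h => hxs (hs h)
      have h2 : F τ =ᶠ[𝓝 x] id := by
        filter_upwards [(isClosed_tsupport ρ).isOpen_compl.mem_nhds hx] with z hz using hFo τ z hz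
      have h1 : dmap (F τ) x = ContinuousLinearMap.id ℝ E :=
        ((hasMFDerivAt_id x).congr_of_eventuallyEq h2).mfderiv
      rw [h1, hFo τ x hx]
      rfl
  exact ⟨Ψ, hsmooth, fun x => by
    by_cases hxs : x ∈ e.source
    · rw [hΨ, hFs _ _ hxs, hΦ.zero, e.left_inv hxs]
    · rw [hΨ, hFo _ _ fun h => hxs (hs h)], hFneg, hFo, ⟨X, hX, hgen⟩, hsymp⟩

end

/-! ### Composing isotopies with Hamiltonian flows -/

section

variable {E : Type*} [NormedAddCommGroup E] [NormedSpace ℝ E]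
  {M : Type*} [TopologicalSpace M] [ChartedSpace E M]

lemma IsHamiltonianIsotopy.contMDiff_ham {Ω : SymplecticForm E M} {I : Set ℝ}
    {φ : ℝ → Diffeo E M} {H : ℝ → M → ℝ} (h : IsHamiltonianIsotopy Ω I φ H) {t : ℝ} (ht : t ∈ I) :
    ContMDiff 𝓘(ℝ, E) 𝓘(ℝ, ℝ) ∞ (H t) := by
  have h1 : ContMDiff 𝓘(ℝ, E) (𝓘(ℝ, ℝ).prod 𝓘(ℝ, E)) ∞ (fun x : M => (t, x)) :=
    contMDiff_const.prodMk contMDiff_id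
  exact contMDiffOn_univ.1 (h.smooth_ham.comp h1.contMDiffOn fun x _ => ⟨ht, trivial⟩)

variable [FiniteDimensional ℝ E] {Ω : SymplecticForm E M} {ρ : M → ℝ} {Ψ : ℝ → Diffeo E M}

namespace IsHamiltonianFlow

lemma apply_neg (hΨ : IsHamiltonianFlow Ω ρ Ψ) (τ : ℝ) (x : M) : Ψ τ (Ψ (-τ) x) = x := by
  simpa using hΨ.neg_apply (-τ) x

lemma dmap_apply_neg (hΨ : IsHamiltonianFlow Ω ρ Ψ) (τ : ℝ) (x : M) (w : E) :
    dmap (Ψ τ) (Ψ (-τ) x) (dmap (Ψ (-τ)) x w) = w := by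
  have h1 := mfderiv_comp x ((Ψ τ).mdifferentiable (by simp) (Ψ (-τ) x))
    ((Ψ (-τ)).mdifferentiable (by simp) x)
  have h2 : Ψ τ ∘ Ψ (-τ) = id := funext (hΨ.apply_neg τ)
  rw [h2, mfderiv_id] at h1
  exact (congrArg (fun A : E →L[ℝ] E => A w) h1).symm

lemma mem_tsupport_union (hΨ : IsHamiltonianFlow Ω ρ Ψ) {K : Set M} {τ : ℝ} {x : M}
    (h : Ψ τ x ∈ K) : x ∈ tsupport ρ ∪ K := by
  by_cases hx : x ∈ tsupport ρ
  · exact Or.inl hx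
  · exact Or.inr (hΨ.eq_self τ x hx ▸ h)

lemma hasMFDerivWithinAt_comp (hΨ : IsHamiltonianFlow Ω ρ Ψ)
    {Z : M → E}
    (hZ : ∀ τ x, HasMFDerivAt 𝓘(ℝ, ℝ) 𝓘(ℝ, E) (fun σ => Ψ σ x) τ
      (ContinuousLinearMap.toSpanSingleton ℝ (Z (Ψ τ x))))
    {θ : ℝ → ℝ} {c : ℝ → M} {I : Set ℝ} {t k : ℝ} {v : E}
    (hθ : HasDerivAt θ k t) (hc : HasMFDerivWithinAt 𝓘(ℝ, ℝ) 𝓘(ℝ, E) c I t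
      (ContinuousLinearMap.toSpanSingleton ℝ v)) {w : E}
    (hw : w = k • Z (Ψ (θ t) (c t)) + dmap (Ψ (θ t)) (c t) v) :
    HasMFDerivWithinAt 𝓘(ℝ, ℝ) 𝓘(ℝ, E) (fun τ => Ψ (θ τ) (c τ)) I t
      (ContinuousLinearMap.toSpanSingleton ℝ w) := by
  have h1 : HasMFDerivWithinAt 𝓘(ℝ, ℝ) 𝓘(ℝ, ℝ) θ I t (ContinuousLinearMap.toSpanSingleton ℝ k) :=
    hθ.hasFDerivAt.hasMFDerivAt.hasMFDerivWithinAt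
  have h2 := h1.prodMk hc
  have h3 := (hΨ.smooth.mdifferentiable (by simp) (θ t, c t))
  have h4 := h3.hasMFDerivAt.comp_hasMFDerivWithinAt t h2
  refine h4.congr_mfderiv ?_
  refine ContinuousLinearMap.ext_ring ?_
  refine (mfderiv_prod_eq_add_apply h3).trans ?_
  have h5 := (hZ (θ t) (c t)).mfderiv
  refine Eq.trans (congrArg₂ (fun a b : E => a + b)
    (congrArg (fun A : ℝ →L[ℝ] E => A ((1 : ℝ) • k)) h5)
    (congrArg (fun a : E => dmap (Ψ (θ t)) (c t) a) (one_smul ℝ v))) ?_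
  refine Eq.trans ?_ (one_smul ℝ w).symm
  rw [hw, one_smul]
  rfl

end IsHamiltonianFlow

/-- Composing a Hamiltonian isotopy with the time-`θ t` map of an autonomous Hamiltonian flow. -/
theorem IsHamiltonianIsotopy.comp_flow {I : Set ℝ} {φ : ℝ → Diffeo E M} {H : ℝ → M → ℝ}
    (hφ : IsHamiltonianIsotopy Ω I φ H) (hΨ : IsHamiltonianFlow Ω ρ Ψ)
    (hρ : ContMDiff 𝓘(ℝ, E) 𝓘(ℝ, ℝ) ∞ ρ) (hc : HasCompactSupport ρ) {θ : ℝ → ℝ}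
    (hθ : ContDiff ℝ ∞ θ) :
    IsHamiltonianIsotopy Ω I (fun t => (φ t).trans (Ψ (θ t)))
      (fun t x => deriv θ t * ρ x + H t (Ψ (-θ t) x)) where
  smooth_isotopy := by
    have h1 : ContMDiffOn (𝓘(ℝ, ℝ).prod 𝓘(ℝ, E)) (𝓘(ℝ, ℝ).prod 𝓘(ℝ, E)) ∞
        (fun z : ℝ × M => (θ z.1, φ z.1 z.2)) (I ×ˢ univ) :=
      (hθ.contMDiff.comp contMDiff_fst).contMDiffOn.prodMk hφ.smooth_isotopy
    exact hΨ.smooth.comp_contMDiffOn h1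
  smooth_ham := by
    have h1 : ContMDiff (𝓘(ℝ, ℝ).prod 𝓘(ℝ, E)) (𝓘(ℝ, ℝ).prod 𝓘(ℝ, E)) ∞
        (fun z : ℝ × M => (-θ z.1, z.2)) :=
      (hθ.neg.contMDiff.comp contMDiff_fst).prodMk contMDiff_snd
    have h2 : ContMDiff (𝓘(ℝ, ℝ).prod 𝓘(ℝ, E)) (𝓘(ℝ, ℝ).prod 𝓘(ℝ, E)) ∞
        (fun z : ℝ × M => (z.1, Ψ (-θ z.1) z.2)) :=
      contMDiff_fst.prodMk (hΨ.smooth.comp h1)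
    have h3 := hφ.smooth_ham.comp (h2.contMDiffOn (s := I ×ˢ univ)) fun z hz => ⟨hz.1, trivial⟩
    have h4 : ContMDiff (𝓘(ℝ, ℝ).prod 𝓘(ℝ, E)) 𝓘(ℝ, ℝ) ∞ (fun z : ℝ × M => deriv θ z.1 * ρ z.2) :=
      ((contDiff_infty_iff_deriv.1 hθ).2.contMDiff.comp contMDiff_fst).mul
        (hρ.comp contMDiff_snd)
    exact h4.contMDiffOn.add h3
  compact_support := by
    intro J hJ hJc
    obtain ⟨K, hK, hKs⟩ := hφ.compact_support J hJ hJc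
    refine ⟨tsupport ρ ∪ K, hc.isCompact.union hK, fun t ht x hx => ?_⟩
    by_cases h1 : ρ x = 0
    · have h2 : H t (Ψ (-θ t) x) ≠ 0 := by
        simpa [h1] using hx
      exact hΨ.mem_tsupport_union (hKs t ht h2)
    · exact Or.inl (subset_tsupport _ h1)
  generates := by
    intro t ht
    obtain ⟨X, hX, hXd⟩ := hφ.generates t ht
    obtain ⟨Z, hZ, hZd⟩ := hΨ.generates
    obtain ⟨Y, hY⟩ := Ω.exists_hamiltonianField
      (fun x => deriv θ t * ρ x + H t (Ψ (-θ t) x))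
    refine ⟨Y, hY, fun x => ?_⟩
    refine hΨ.hasMFDerivWithinAt_comp hZd
      (hθ.differentiable (by simp) t).hasDerivAt (hXd x) ?_
    -- By nondegeneracy the velocities may be compared after pairing with `w`. The transported field
    -- pairs as `Ω(dΨ X, w) = Ω(X, dΨ⁻¹ w) = dH(dΨ⁻¹ w)`, since `Ψ` is symplectic.
    refine Ω.eq_of_bilin (x := Ψ (θ t) (φ t x)) fun w => ?_
    set z := Ψ (θ t) (φ t x) with hz
    have hzx : Ψ (-θ t) z = φ t x := hΨ.neg_apply _ _
    have h1 : dfun (fun x => deriv θ t * ρ x + H t (Ψ (-θ t) x)) z w =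
        deriv θ t * dfun ρ z w + dfun (H t) (φ t x) (dmap (Ψ (-θ t)) z w) := by
      have h2 : HasMFDerivAt 𝓘(ℝ, E) 𝓘(ℝ, ℝ) ρ z (dfun (E := E) ρ z) :=
        (hρ.mdifferentiable (by simp) z).hasMFDerivAt
      have h3 : HasMFDerivAt 𝓘(ℝ, E) 𝓘(ℝ, ℝ) (H t) (Ψ (-θ t) z) (dfun (E := E) (H t) (Ψ (-θ t) z)) :=
        ((hφ.contMDiff_ham ht).mdifferentiable (by simp) _).hasMFDerivAt
      have h4 : HasMFDerivAt 𝓘(ℝ, E) 𝓘(ℝ, E) (Ψ (-θ t)) z (dmap (E := E) (Ψ (-θ t)) z) :=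
        ((Ψ (-θ t)).mdifferentiable (by simp) z).hasMFDerivAt
      have h5 := (h2.const_smul (deriv θ t)).add (h3.comp z h4)
      rw [← hzx]
      exact congrArg (fun A : E →L[ℝ] ℝ => A w) h5.mfderiv
    have h6 : Ω.bilin z (dmap (Ψ (θ t)) (φ t x) (X (φ t x))) w =
        dfun (H t) (φ t x) (dmap (Ψ (-θ t)) z w) := by
      have h7 := hΨ.dmap_apply_neg (θ t) z w
      rw [hzx] at h7
      have h8 := hΨ.symplectic (θ t) (φ t x) (X (φ t x)) (dmap (Ψ (-θ t)) z w)
      rw [h7] at h8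
      exact h8.trans (hX (φ t x) _)
    have h9 : Ω.bilin z (Z z) w = dfun ρ z w := hZ z w
    have h10 : ∀ (k : ℝ) (a b : E),
        Ω.bilin z (k • a + b) w = k * Ω.bilin z a w + Ω.bilin z b w := fun k a b => by simp
    rw [← h9, ← h6] at h1
    exact Eq.trans (hY z w) (h1.trans (h10 _ _ _).symm)

/-- `Ham^c(M)` is stable under composition with the maps of an autonomous Hamiltonian flow. -/
lemma trans_mem_HamC (hΨ : IsHamiltonianFlow Ω ρ Ψ)
    (hρ : ContMDiff 𝓘(ℝ, E) 𝓘(ℝ, ℝ) ∞ ρ) (hc : HasCompactSupport ρ) {g : Diffeo E M}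
    (hg : g ∈ HamC Ω) (τ : ℝ) : g.trans (Ψ τ) ∈ HamC Ω := by
  obtain ⟨φ, H, hφ, h0, h1⟩ := hg
  -- The linear function `τ * t` keeps the start at the identity and reaches `Ψ τ` at time one.
  refine ⟨_, _, hφ.comp_flow hΨ hρ hc (θ := fun t => τ * t) (contDiff_const.mul contDiff_id),
    ?_, ?_⟩
  · ext x
    simp [h0, hΨ.zero]
  · simp [h1]

/-- The path `t ↦ Ψ_{θ(t)} ∘ φ_t`. -/
def HamPath.compFlow {I : Set ℝ} (γ : HamPath Ω I) (hΨ : IsHamiltonianFlow Ω ρ Ψ)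
    (hρ : ContMDiff 𝓘(ℝ, E) 𝓘(ℝ, ℝ) ∞ ρ) (hc : HasCompactSupport ρ) {θ : ℝ → ℝ}
    (hθ : ContDiff ℝ ∞ θ) : HamPath Ω I where
  φ := fun t => (γ.φ t).trans (Ψ (θ t))
  H := fun t x => deriv θ t * ρ x + γ.H t (Ψ (-θ t) x)
  isotopy := γ.isotopy.comp_flow hΨ hρ hc hθ
  mem := fun t ht => trans_mem_HamC hΨ hρ hc (γ.mem t ht) _

end

/-! ### Deformations of a path with fixed endpoints -/

section

variable {E : Type*} [NormedAddCommGroup E] [NormedSpace ℝ E]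
  {M : Type*} [TopologicalSpace M] [ChartedSpace E M]

lemma HamPath.ext_of_eq {Ω : SymplecticForm E M} {I : Set ℝ} {γ η : HamPath Ω I} (h1 : γ.φ = η.φ)
    (h2 : γ.H = η.H) : γ = η := by
  cases γ
  cases η
  cases h1
  cases h2
  rfl

variable {Ω : SymplecticForm E M}

/-- `Γ` is a smooth deformation of `γ` with fixed endpoints and compact support. In coordinates
`χ` that move with the deformation its Hamiltonian is `H_t + s R_{s,t}`, and `R_{0,t} = G_t`. -/
structure IsDeformation {a b : ℝ} (γ : HamPath Ω (Icc a b)) (G : ℝ → M → ℝ)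
    (Γ : ℝ → HamPath Ω (Icc a b)) (χ : ℝ → ℝ → M → M) (R : ℝ → ℝ → M → ℝ) : Prop where
  zero : Γ 0 = γ
  smooth : ContMDiffOn (𝓘(ℝ, ℝ).prod (𝓘(ℝ, ℝ).prod 𝓘(ℝ, E))) 𝓘(ℝ, E) ∞
    (fun z : ℝ × ℝ × M => (Γ z.1).φ z.2.1 z.2.2) (univ ×ˢ (Icc a b ×ˢ univ))
  left : ∀ s, (Γ s).φ a = γ.φ a
  right : ∀ s, (Γ s).φ b = γ.φ b
  support : ∃ K, IsCompact K ∧ ∀ s, ∀ t ∈ Icc a b, ∀ x ∉ K, (Γ s).φ t x = γ.φ t x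
  χ_surjective : ∀ s t, Function.Surjective (χ s t)
  χ_continuous : Continuous fun z : ℝ × ℝ × M => χ z.1 z.2.1 z.2.2
  χ_zero : ∀ t x, χ 0 t x = x
  χ_support : ∃ K, IsCompact K ∧ ∀ s t, ∀ x ∉ K, χ s t x = x
  R_continuous : Continuous fun z : ℝ × ℝ × M => R z.1 z.2.1 z.2.2
  R_zero : ∀ t x, R 0 t x = G t x
  R_support : ∃ K, IsCompact K ∧ ∀ s t, ∀ x ∉ K, R s t x = 0
  ham : ∀ s, ∀ t ∈ Icc a b, ∀ x, (Γ s).H t (χ s t x) = γ.H t x + s * R s t x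

lemma isDeformation_const {a b : ℝ} (γ : HamPath Ω (Icc a b)) :
    IsDeformation γ 0 (fun _ => γ) (fun _ _ x => x) (fun _ _ _ => 0) where
  zero := rfl
  smooth := γ.isotopy.smooth_isotopy.comp contMDiff_snd.contMDiffOn fun z hz => hz.2
  left := fun _ => rfl
  right := fun _ => rfl
  support := ⟨∅, isCompact_empty, fun _ _ _ _ _ => rfl⟩
  χ_surjective := fun _ _ => Function.surjective_id
  χ_continuous := continuous_snd.comp continuous_snd
  χ_zero := fun _ _ => rfl
  χ_support := ⟨∅, isCompact_empty, fun _ _ _ _ => rfl⟩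
  R_continuous := continuous_const
  R_zero := fun _ _ => rfl
  R_support := ⟨∅, isCompact_empty, fun _ _ _ _ => rfl⟩
  ham := fun s t _ x => by simp

variable [FiniteDimensional ℝ E]

/-- The trajectories that meet a given compact set start in a compact set. -/
lemma HamPath.exists_compact_notMem [IsManifold 𝓘(ℝ, E) ∞ M] [T2Space M] [SecondCountableTopology M]
    {a b : ℝ} (γ : HamPath Ω (Icc a b)) {S : Set M} (hS : IsCompact S) :
    ∃ K, IsCompact K ∧ ∀ t ∈ Icc a b, ∀ x ∉ K, γ.φ t x ∉ S := by
  have : LocallyCompactSpace M := Manifold.locallyCompact_of_finiteDimensional 𝓘(ℝ, E)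
  obtain ⟨K₀, hK₀, hsupp⟩ := γ.isotopy.compact_support (Icc a b) Subset.rfl isCompact_Icc
  obtain ⟨K₁, hK₁, hint⟩ := exists_compact_superset (hK₀.union hS)
  obtain ⟨f, hf1, hf0, -⟩ := exists_contMDiffMap_one_nhds_of_subset_interior 𝓘(ℝ, E) (n := ⊤)
    (hK₀.union hS).isClosed hint
  have hfs : ContMDiff 𝓘(ℝ, E) 𝓘(ℝ, ℝ) ∞ f := f.contMDiff
  -- The cut-off `f` is constant along trajectories: it equals `1` near `K₀ ∪ S`, and the field
  -- vanishes off `K₀`. A trajectory meeting `S` therefore starts where `f = 1`, hence in `K₁`.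
  refine ⟨(γ.φ a).symm '' K₁, hK₁.image (γ.φ a).symm.continuous, fun t ht x hx hxS => ?_⟩
  have hd : ∀ r ∈ Icc a b, HasDerivWithinAt (fun r => f (γ.φ r x)) 0 (Icc a b) r := by
    intro r hr
    obtain ⟨X, hX, hXd⟩ := γ.isotopy.generates r hr
    have h1 : HasMFDerivAt 𝓘(ℝ, E) 𝓘(ℝ, ℝ) f (γ.φ r x) (dfun (E := E) f (γ.φ r x)) :=
      (hfs.mdifferentiable (by simp) _).hasMFDerivAt
    have h2 : dfun (E := E) f (γ.φ r x) (X (γ.φ r x) : E) = 0 := by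
      by_cases hy : γ.φ r x ∈ K₀ ∪ S
      · have h3 : f =ᶠ[𝓝 (γ.φ r x)] fun _ => (1 : ℝ) :=
          hf1.filter_mono (nhds_le_nhdsSet hy)
        have h4 : dfun f (γ.φ r x) = (0 : E →L[ℝ] ℝ) := h3.mfderiv_eq.trans mfderiv_const
        rw [h4]
        rfl
      · have h5 : X (γ.φ r x) = 0 := hX.eq_zero fun h => hy (Or.inl
          (closure_minimal (hsupp r hr) hK₀.isClosed h))
        exact (congrArg (fun v : E => dfun (E := E) f (γ.φ r x) v) h5).trans (map_zero _)
    have h6 : HasFDerivWithinAt (fun r => f (γ.φ r x)) (dfun (E := E) f (γ.φ r x) ∘L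
        ContinuousLinearMap.toSpanSingleton ℝ (X (γ.φ r x) : E)) (Icc a b) r :=
      hasMFDerivWithinAt_iff_hasFDerivWithinAt.1 (h1.comp_hasMFDerivWithinAt r (hXd x))
    refine h6.hasDerivWithinAt.congr_deriv (Eq.trans ?_ h2)
    exact congrArg (fun v : E => dfun (E := E) f (γ.φ r x) v) (one_smul ℝ _)
  have hab : a ≤ b := ht.1.trans ht.2
  have hconst := constant_of_derivWithin_zero (fun r hr => (hd r hr).differentiableWithinAt)
    (fun r hr => by
      have hab' : a < b := hr.1.trans_lt hr.2
      exact (hd r (Ico_subset_Icc_self hr)).derivWithin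
        (uniqueDiffOn_Icc hab' r (Ico_subset_Icc_self hr))) t ht
  have h1 : f (γ.φ t x) = 1 := hf1.self_of_nhdsSet _ (Or.inr hxS)
  have h2 : f (γ.φ a x) = 0 := hf0 _ fun h => hx ⟨_, h, (γ.φ a).symm_apply_apply x⟩
  rw [h1, h2] at hconst
  exact one_ne_zero hconst

/-- Evaluated at `Ψ (s θ) (χ x)`, the pulled-back old Hamiltonian becomes its value at `χ x`, and
the new term is `s θ' ρ` at the moved point. So the form `H + s R` persists, and `R` at `s = 0`
gains `θ' ρ`. -/
lemma IsDeformation.compFlow [IsManifold 𝓘(ℝ, E) ∞ M] [T2Space M] [SecondCountableTopology M]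
    {a b : ℝ} {γ : HamPath Ω (Icc a b)} {G : ℝ → M → ℝ}
    {Γ : ℝ → HamPath Ω (Icc a b)} {χ : ℝ → ℝ → M → M} {R : ℝ → ℝ → M → ℝ}
    (h : IsDeformation γ G Γ χ R) {ρ : M → ℝ} {Ψ : ℝ → Diffeo E M}
    (hΨ : IsHamiltonianFlow Ω ρ Ψ) (hρ : ContMDiff 𝓘(ℝ, E) 𝓘(ℝ, ℝ) ∞ ρ) (hc : HasCompactSupport ρ)
    {θ : ℝ → ℝ} (hθ : ContDiff ℝ ∞ θ) (ha : θ a = 0) (hb : θ b = 0) :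
    IsDeformation γ (fun t x => G t x + deriv θ t * ρ x)
      (fun s => (Γ s).compFlow hΨ hρ hc (θ := fun t => s * θ t) (contDiff_const.mul hθ))
      (fun s t x => Ψ (s * θ t) (χ s t x))
      (fun s t x => R s t x + deriv θ t * ρ (Ψ (s * θ t) (χ s t x))) := by
  have hχ : Continuous fun z : ℝ × ℝ × M => Ψ (z.1 * θ z.2.1) (χ z.1 z.2.1 z.2.2) :=
    hΨ.smooth.continuous.comp ((continuous_fst.mul (hθ.continuous.comp
      (continuous_fst.comp continuous_snd))).prodMk h.χ_continuous)
  have hχs : ∃ K, IsCompact K ∧ tsupport ρ ⊆ K ∧ ∀ s t, ∀ x ∉ K, Ψ (s * θ t) (χ s t x) = x := by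
    obtain ⟨K, hK, hKs⟩ := h.χ_support
    refine ⟨K ∪ tsupport ρ, hK.union hc.isCompact, subset_union_right, fun s t x hx => ?_⟩
    rw [hKs s t x fun h => hx (Or.inl h), hΨ.eq_self _ x fun h => hx (Or.inr h)]
  exact
    { zero := by
        rw [h.zero]
        refine HamPath.ext_of_eq ?_ ?_
        · funext t
          refine Diffeomorph.ext fun x => ?_
          simp [HamPath.compFlow, hΨ.zero]
        · funext t x
          simp [HamPath.compFlow, hΨ.zero]
      smooth := by
        have h1 : ContMDiff (𝓘(ℝ, ℝ).prod (𝓘(ℝ, ℝ).prod 𝓘(ℝ, E))) 𝓘(ℝ, ℝ) ∞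
            (fun z : ℝ × ℝ × M => z.1 * θ z.2.1) :=
          contMDiff_fst.mul (hθ.contMDiff.comp (contMDiff_fst.comp contMDiff_snd))
        exact hΨ.smooth.comp_contMDiffOn (h1.contMDiffOn.prodMk h.smooth)
      left := fun s => by
        refine Diffeomorph.ext fun x => ?_
        simp [HamPath.compFlow, hΨ.zero, ha, h.left]
      right := fun s => by
        refine Diffeomorph.ext fun x => ?_
        simp [HamPath.compFlow, hΨ.zero, hb, h.right]
      support := by
        obtain ⟨K, hK, hKs⟩ := h.support
        -- The flow changes a trajectory only where it meets `tsupport ρ`; such trajectories start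
        -- in a compact set.
        obtain ⟨K', hK', hKs'⟩ := γ.exists_compact_notMem hc.isCompact
        refine ⟨K ∪ K', hK.union hK', fun s t ht x hx => ?_⟩
        have h1 := hKs s t ht x fun h => hx (Or.inl h)
        change Ψ (s * θ t) ((Γ s).φ t x) = _
        rw [h1]
        exact hΨ.eq_self _ _ (hKs' t ht x fun h => hx (Or.inr h))
      χ_surjective := fun s t => (Ψ (s * θ t)).surjective.comp (h.χ_surjective s t)
      χ_continuous := hχ
      χ_zero := fun t x => by simp [hΨ.zero, h.χ_zero]
      χ_support := by
        obtain ⟨K, hK, -, hKs⟩ := hχs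
        exact ⟨K, hK, hKs⟩
      R_continuous := h.R_continuous.add (((hθ.continuous_deriv (by simp)).comp
        (continuous_fst.comp continuous_snd)).mul (hρ.continuous.comp hχ))
      R_zero := fun t x => by simp [hΨ.zero, h.χ_zero, h.R_zero]
      R_support := by
        obtain ⟨K, hK, hρK, hKs⟩ := hχs
        obtain ⟨K', hK', hKs'⟩ := h.R_support
        refine ⟨K ∪ K', hK.union hK', fun s t x hx => ?_⟩
        have h1 : ρ x = 0 := image_eq_zero_of_notMem_tsupport fun h => hx (Or.inl (hρK h))
        rw [hKs s t x fun h => hx (Or.inl h), hKs' s t x fun h => hx (Or.inr h), h1]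
        simp
      ham := fun s t ht x => by
        have h1 : deriv (fun t => s * θ t) t = s * deriv θ t :=
          deriv_const_mul s (hθ.differentiable (by simp) t)
        simp only [HamPath.compFlow]
        rw [h1, hΨ.neg_apply, h.ham s t ht x]
        ring }

/-- A finite sum of products of functions of time and functions supported in charts is the first
variation of a deformation. -/
theorem exists_isDeformation [IsManifold 𝓘(ℝ, E) ∞ M] [T2Space M] [SecondCountableTopology M]
    {a b : ℝ} (γ : HamPath Ω (Icc a b)) {ι : Type*} (F : Finset ι) (ρ : ι → M → ℝ) (p : ι → M)
    (θ : ι → ℝ → ℝ) (hρ : ∀ i ∈ F, ContMDiff 𝓘(ℝ, E) 𝓘(ℝ, ℝ) ∞ (ρ i))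
    (hc : ∀ i ∈ F, HasCompactSupport (ρ i)) (hp : ∀ i ∈ F, tsupport (ρ i) ⊆ (chartAt E (p i)).source)
    (hθ : ∀ i ∈ F, ContDiff ℝ ∞ (θ i)) (ha : ∀ i ∈ F, θ i a = 0) (hb : ∀ i ∈ F, θ i b = 0) :
    ∃ Γ χ R, IsDeformation γ (fun t x => ∑ i ∈ F, deriv (θ i) t * ρ i x) Γ χ R := by
  classical
  induction F using Finset.induction_on with
  | empty => exact ⟨_, _, _, isDeformation_const γ⟩
  | insert i F hi ih =>
    have hF : ∀ j ∈ F, j ∈ insert i F := fun j => Finset.mem_insert_of_mem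
    have hi' := Finset.mem_insert_self i F
    obtain ⟨Γ, χ, R, h⟩ := ih (fun j hj => hρ j (hF j hj)) (fun j hj => hc j (hF j hj))
      (fun j hj => hp j (hF j hj)) (fun j hj => hθ j (hF j hj)) (fun j hj => ha j (hF j hj))
      (fun j hj => hb j (hF j hj))
    obtain ⟨Ψ, hΨ⟩ := exists_isHamiltonianFlow Ω (p i) (hρ i hi') (hc i hi') (hp i hi')
    have h1 : (fun t x => ∑ j ∈ insert i F, deriv (θ j) t * ρ j x) =
        fun t x => (∑ j ∈ F, deriv (θ j) t * ρ j x) + deriv (θ i) t * ρ i x := by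
      funext t x
      rw [Finset.sum_insert hi, add_comm]
    rw [h1]
    exact ⟨_, _, _, h.compFlow hΨ (hρ i hi') (hc i hi') (hθ i hi') (ha i hi') (hb i hi')⟩

end

/-! ### Continuity of deformations in the strong smooth topology -/

section

/-- The iterated derivatives of a smooth family depend smoothly on the parameter. -/
lemma contDiffWithinAt_iteratedFDerivWithin {P F G : Type*} [NormedAddCommGroup P]
    [NormedSpace ℝ P] [NormedAddCommGroup F] [NormedSpace ℝ F] [NormedAddCommGroup G]
    [NormedSpace ℝ G] {f : P → F → G} {W : Set F} (hW : UniqueDiffOn ℝ W) {s₀ : P} {z₀ : F}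
    (hz₀ : z₀ ∈ W) (hf : ContDiffWithinAt ℝ ∞ (Function.uncurry f) (univ ×ˢ W) (s₀, z₀)) (k : ℕ) :
    ContDiffWithinAt ℝ ∞ (Function.uncurry fun s z => iteratedFDerivWithin ℝ k (f s) W z)
      (univ ×ˢ W) (s₀, z₀) := by
  induction k with
  | zero =>
    have h1 := (continuousMultilinearCurryFin0 ℝ F G).symm.contDiff (n := ∞)
    exact h1.contDiffAt.comp_contDiffWithinAt (s₀, z₀) hf
  | succ k ih =>
    -- The base point is included among the parameters, so the next derivative in `w` can be taken
    -- at a point varying with them.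
    have h1 : ContDiffWithinAt ℝ ∞ (Function.uncurry fun (x : P × F) w =>
        iteratedFDerivWithin ℝ k (f x.1) W w) ((univ ×ˢ W) ×ˢ W) ((s₀, z₀), z₀) :=
      ContDiffWithinAt.comp ((s₀, z₀), z₀) (t := univ ×ˢ W)
        (f := fun y : (P × F) × F => (y.1.1, y.2)) ih
        ((contDiff_fst.comp contDiff_fst).prodMk contDiff_snd).contDiffWithinAt
        fun y hy => ⟨trivial, hy.2⟩
    have h2 := h1.fderivWithin (g := Prod.snd) contDiff_snd.contDiffWithinAt hW
      (m := ∞) (by simp) ⟨trivial, hz₀⟩ fun y hy => hy.2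
    have h3 := LinearIsometryEquiv.contDiff (𝕜 := ℝ) (E := F →L[ℝ] F [×k]→L[ℝ] G)
      (F := F [×(k + 1)]→L[ℝ] G) (n := ∞)
      (continuousMultilinearCurryLeftEquiv ℝ (fun _ : Fin (k + 1) => F) G).symm
    exact h3.contDiffAt.comp_contDiffWithinAt (s₀, z₀) h2

variable {E : Type*} [NormedAddCommGroup E] [NormedSpace ℝ E]
  {M : Type*} [TopologicalSpace M] [ChartedSpace E M]

/-- The partial derivatives in charts of a smooth family of maps are continuous. -/
lemma continuousWithinAt_iteratedFDerivWithin_inCharts [IsManifold 𝓘(ℝ, E) ∞ M]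
    {Ω : SymplecticForm E M} {a b : ℝ} (hab : a < b) {Γ : ℝ → HamPath Ω (Icc a b)}
    (hΓ : ContMDiffOn (𝓘(ℝ, ℝ).prod (𝓘(ℝ, ℝ).prod 𝓘(ℝ, E))) 𝓘(ℝ, E) ∞
      (fun z : ℝ × ℝ × M => (Γ z.1).φ z.2.1 z.2.2) (univ ×ˢ (Icc a b ×ˢ univ)))
    {p q : M} {s : ℝ} {z : ℝ × M} (hz : z ∈ Icc a b ×ˢ (chartAt E p).source)
    (hq : (Γ s).φ z.1 z.2 ∈ (chartAt E q).source) (k : ℕ) :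
    ContinuousWithinAt (fun y : ℝ × ℝ × M => iteratedFDerivWithin ℝ k ((Γ y.1).inCharts p q)
      (Icc a b ×ˢ (chartAt E p).target) (y.2.1, chartAt E p y.2.2))
      (univ ×ˢ (Icc a b ×ˢ (chartAt E p).source)) (s, z) := by
  set W := Icc a b ×ˢ (chartAt E p).target
  have hW : UniqueDiffOn ℝ W :=
    (uniqueDiffOn_Icc hab).prod (chartAt E p).open_target.uniqueDiffOn
  have hx : (chartAt E p).symm (chartAt E p z.2) = z.2 := (chartAt E p).left_inv hz.2
  have hzW : (z.1, chartAt E p z.2) ∈ W := ⟨hz.1, (chartAt E p).map_source hz.2⟩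
  have h1 : ContDiffWithinAt ℝ ∞ (Function.uncurry fun s w => (Γ s).inCharts p q w) (univ ×ˢ W)
      (s, (z.1, chartAt E p z.2)) := by
    rw [← contMDiffWithinAt_iff_contDiffWithinAt]
    have h2 : ContMDiffWithinAt 𝓘(ℝ, ℝ × ℝ × E) (𝓘(ℝ, ℝ).prod (𝓘(ℝ, ℝ).prod 𝓘(ℝ, E))) ∞
        (fun y : ℝ × ℝ × E => (y.1, (y.2.1, (chartAt E p).symm y.2.2))) (univ ×ˢ W)
        (s, (z.1, chartAt E p z.2)) := by
      have h3 : ContMDiffWithinAt 𝓘(ℝ, ℝ × ℝ × E) 𝓘(ℝ, E) ∞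
          (fun y : ℝ × ℝ × E => (chartAt E p).symm y.2.2) (univ ×ˢ W)
          (s, (z.1, chartAt E p z.2)) :=
        ContMDiffWithinAt.comp (s, (z.1, chartAt E p z.2)) (t := (chartAt E p).target)
          (contMDiffOn_chart_symm (I := 𝓘(ℝ, E)) (x := p) _ hzW.2)
          (contDiff_snd.comp contDiff_snd).contMDiff.contMDiffAt.contMDiffWithinAt
          fun y hy => hy.2.2
      exact contDiff_fst.contMDiff.contMDiffAt.contMDiffWithinAt.prodMk
        ((contDiff_fst.comp contDiff_snd).contMDiff.contMDiffAt.contMDiffWithinAt.prodMk h3)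
    have h4 := (hΓ (s, z) ⟨trivial, hz.1, trivial⟩)
    have h5 : ContMDiffWithinAt 𝓘(ℝ, ℝ × ℝ × E) 𝓘(ℝ, E) ∞
        (fun y : ℝ × ℝ × E => (Γ y.1).φ y.2.1 ((chartAt E p).symm y.2.2)) (univ ×ˢ W)
        (s, (z.1, chartAt E p z.2)) :=
      ContMDiffWithinAt.comp_of_eq (x := (s, (z.1, chartAt E p z.2))) h4 h2
        (fun y hy => ⟨trivial, hy.2.1, trivial⟩) (by simp only [hx])
    have h6 : ContMDiffAt 𝓘(ℝ, E) 𝓘(ℝ, E) ∞ (chartAt E q) ((Γ s).φ z.1 z.2) :=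
      contMDiffAt_of_mem_maximalAtlas (IsManifold.chart_mem_maximalAtlas q) hq
    refine ContMDiffAt.comp_contMDiffWithinAt (s, (z.1, chartAt E p z.2)) ?_ h5
    simp only [hx]
    exact h6
  have h7 := (contDiffWithinAt_iteratedFDerivWithin hW hzW h1 k).continuousWithinAt
  refine ContinuousWithinAt.comp (x := (s, z)) (t := univ ×ˢ W)
    (f := fun y : ℝ × ℝ × M => (y.1, (y.2.1, chartAt E p y.2.2))) h7 ?_
    fun y hy => ⟨trivial, hy.2.1, (chartAt E p).map_source hy.2.2⟩
  refine continuousWithinAt_fst.prodMk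
    ((continuous_fst.comp continuous_snd).continuousWithinAt.prodMk ?_)
  exact ContinuousWithinAt.comp (x := (s, z)) (t := (chartAt E p).source)
    ((chartAt E p).continuousOn z.2 hz.2) (continuous_snd.comp continuous_snd).continuousWithinAt
    fun y hy => hy.2.2

lemma HamPath.iteratedFDerivWithin_inCharts_congr {Ω : SymplecticForm E M} {I : Set ℝ}
    {γ η : HamPath Ω I} {K : Set M} (hK : IsClosed K) (h : ∀ t ∈ I, ∀ x ∉ K, γ.φ t x = η.φ t x)
    {p : M} (q : M) {z : ℝ × M} (hz : z ∈ I ×ˢ (chartAt E p).source) (hzK : z.2 ∉ K) (k : ℕ) :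
    iteratedFDerivWithin ℝ k (γ.inCharts p q) (I ×ˢ (chartAt E p).target) (z.1, chartAt E p z.2) =
      iteratedFDerivWithin ℝ k (η.inCharts p q) (I ×ˢ (chartAt E p).target)
        (z.1, chartAt E p z.2) := by
  have hzW : (z.1, chartAt E p z.2) ∈ I ×ˢ (chartAt E p).target :=
    ⟨hz.1, (chartAt E p).map_source hz.2⟩
  have h1 : ∀ᶠ y in 𝓝 (chartAt E p z.2), (chartAt E p).symm y ∉ K := by
    have h1 : Tendsto (chartAt E p).symm (𝓝 (chartAt E p z.2)) (𝓝 z.2) := by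
      have := (chartAt E p).continuousAt_symm ((chartAt E p).map_source hz.2)
      rwa [ContinuousAt, (chartAt E p).left_inv hz.2] at this
    exact h1.eventually (hK.isOpen_compl.mem_nhds hzK)
  have h2 : γ.inCharts p q =ᶠ[𝓝[I ×ˢ (chartAt E p).target] (z.1, chartAt E p z.2)]
      η.inCharts p q := by
    filter_upwards [nhdsWithin_le_nhds (continuous_snd.continuousAt.eventually h1),
      self_mem_nhdsWithin] with y hy hyW
    exact congrArg _ (h y.1 hyW.1 _ hy)
  exact h2.iteratedFDerivWithin_eq (h2.self_of_nhdsWithin hzW) k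

/-- A smooth deformation with compact support is continuous in the strong topology. -/
theorem continuous_hamPath [IsManifold 𝓘(ℝ, E) ∞ M] [T2Space M]
    {Ω : SymplecticForm E M} {a b : ℝ} (hab : a < b) {γ : HamPath Ω (Icc a b)}
    {Γ : ℝ → HamPath Ω (Icc a b)}
    (hΓ : ContMDiffOn (𝓘(ℝ, ℝ).prod (𝓘(ℝ, ℝ).prod 𝓘(ℝ, E))) 𝓘(ℝ, E) ∞
      (fun z : ℝ × ℝ × M => (Γ z.1).φ z.2.1 z.2.2) (univ ×ˢ (Icc a b ×ˢ univ)))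
    (hs : ∃ K, IsCompact K ∧ ∀ s, ∀ t ∈ Icc a b, ∀ x ∉ K, (Γ s).φ t x = γ.φ t x) :
    Continuous Γ := by
  obtain ⟨K, hK, hKs⟩ := hs
  refine continuous_generateFrom_iff.2 ?_
  rintro _ ⟨γ₀, L, p, q, n, ε, hL, hLi, rfl⟩
  refine isOpen_iff_eventually.2 fun s₀ hs₀ => ?_
  -- Only finitely many of the conditions concern the compact set where the deformation moves
  -- points; the others persist unchanged.
  have hfin := hL.finite_nonempty_inter_compact (isCompact_Icc.prod hK : IsCompact (Icc a b ×ˢ K))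
  have hev : ∀ i, ∀ᶠ s in 𝓝 s₀, ∀ z ∈ L i ∩ (Icc a b ×ˢ K),
      (Γ s).φ z.1 z.2 ∈ (chartAt E (q i)).source ∧ ∀ k ≤ n i,
      ‖iteratedFDerivWithin ℝ k ((Γ s).inCharts (p i) (q i)) (Icc a b ×ˢ (chartAt E (p i)).target)
          (z.1, chartAt E (p i) z.2) -
        iteratedFDerivWithin ℝ k (γ₀.inCharts (p i) (q i)) (Icc a b ×ˢ (chartAt E (p i)).target)
          (z.1, chartAt E (p i) z.2)‖ < ε i := by
    intro i
    obtain ⟨hLc, hLs, hε, hLq⟩ := hLi i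
    have hc : IsCompact (L i ∩ (Icc a b ×ˢ K)) :=
      hLc.inter_right (isClosed_Icc.prod hK.isClosed)
    have h1 : ∀ z ∈ L i ∩ (Icc a b ×ˢ K), ∀ᶠ y in 𝓝 (s₀, z), y.2 ∈ L i →
        (Γ y.1).φ y.2.1 y.2.2 ∈ (chartAt E (q i)).source ∧ ∀ k ≤ n i,
        ‖iteratedFDerivWithin ℝ k ((Γ y.1).inCharts (p i) (q i))
            (Icc a b ×ˢ (chartAt E (p i)).target) (y.2.1, chartAt E (p i) y.2.2) -
          iteratedFDerivWithin ℝ k (γ₀.inCharts (p i) (q i))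
            (Icc a b ×ˢ (chartAt E (p i)).target) (y.2.1, chartAt E (p i) y.2.2)‖ < ε i := by
      intro z hz
      have h2 : ∀ᶠ y in 𝓝[univ ×ˢ (Icc a b ×ˢ (chartAt E (p i)).source)] (s₀, z),
          (Γ y.1).φ y.2.1 y.2.2 ∈ (chartAt E (q i)).source :=
        ((hΓ (s₀, z) ⟨trivial, (hLs hz.1).1, trivial⟩).continuousWithinAt.mono
          fun y hy => ⟨trivial, hy.2.1, trivial⟩).eventually
          ((chartAt E (q i)).open_source.mem_nhds (hs₀ i z hz.1).1)
      have h3 : ∀ᶠ y in 𝓝[univ ×ˢ (Icc a b ×ˢ (chartAt E (p i)).source)] (s₀, z), ∀ k ∈ Iic (n i),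
          ‖iteratedFDerivWithin ℝ k ((Γ y.1).inCharts (p i) (q i))
            (Icc a b ×ˢ (chartAt E (p i)).target) (y.2.1, chartAt E (p i) y.2.2) -
          iteratedFDerivWithin ℝ k (γ₀.inCharts (p i) (q i))
            (Icc a b ×ˢ (chartAt E (p i)).target) (y.2.1, chartAt E (p i) y.2.2)‖ < ε i := by
        refine (eventually_all_finite (finite_Iic _)).2 fun k hk => ?_
        have h4 := continuousWithinAt_iteratedFDerivWithin_inCharts hab hΓ (hLs hz.1)
          (hs₀ i z hz.1).1 k
        -- The centre `γ₀` of the ball need not belong to the deformation; its derivatives are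
        -- treated as those of a constant family.
        have h5 := continuousWithinAt_iteratedFDerivWithin_inCharts hab (Γ := fun _ => γ₀)
          (s := s₀) (γ₀.isotopy.smooth_isotopy.comp contMDiff_snd.contMDiffOn fun z hz => hz.2)
          (hLs hz.1) (hLq z hz.1) k
        exact (h4.sub h5).norm.eventually (Iio_mem_nhds ((hs₀ i z hz.1).2 k hk))
      filter_upwards [eventually_nhdsWithin_iff.1 (h2.and h3)] with y hy hyL
      exact hy ⟨trivial, hLs hyL⟩
    filter_upwards [hc.eventually_forall_of_forall_eventually (P := fun s z => z ∈ L i →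
        (Γ s).φ z.1 z.2 ∈ (chartAt E (q i)).source ∧ ∀ k ≤ n i,
        ‖iteratedFDerivWithin ℝ k ((Γ s).inCharts (p i) (q i))
            (Icc a b ×ˢ (chartAt E (p i)).target) (z.1, chartAt E (p i) z.2) -
          iteratedFDerivWithin ℝ k (γ₀.inCharts (p i) (q i))
            (Icc a b ×ˢ (chartAt E (p i)).target) (z.1, chartAt E (p i) z.2)‖ < ε i) h1]
      with s hs z hz
    exact hs z hz hz.1
  have hev' := (eventually_all_finite hfin).2 fun i _ => hev i
  filter_upwards [hev'] with s hs i z hz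
  by_cases hzK : z.2 ∈ K
  · have h1 : z ∈ L i ∩ (Icc a b ×ˢ K) := ⟨hz, ((hLi i).2.1 hz).1, hzK⟩
    exact hs i ⟨z, h1⟩ z h1
  · have h1 : ∀ t ∈ Icc a b, ∀ x ∉ K, (Γ s).φ t x = (Γ s₀).φ t x := fun t ht x hx =>
      (hKs s t ht x hx).trans (hKs s₀ t ht x hx).symm
    obtain ⟨h2, h3⟩ := hs₀ i z hz
    have h4 := (hLi i).2.1 hz
    refine ⟨by rwa [h1 z.1 h4.1 z.2 hzK], fun k hk => ?_⟩
    rw [HamPath.iteratedFDerivWithin_inCharts_congr hK.isClosed h1 (q i) h4 hzK]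
    exact h3 k hk

end

/-! ### A first variation that favours minima -/

section

/-- Near each point of `[a, b]` there are bump functions of total mass one. -/
lemma exists_normed_bump {a b t : ℝ} (hab : a < b) (ht : t ∈ Icc a b) {J : Set ℝ}
    (hJ : J ∈ 𝓝[Icc a b] t) :
    ∃ β : ℝ → ℝ, ContDiff ℝ ∞ β ∧ (∀ r, 0 ≤ β r) ∧ (∀ r ∉ J ∩ Icc a b, β r = 0) ∧
      ∫ r in a..b, β r = 1 ∧
      ∃ c d k, a ≤ c ∧ c < d ∧ d ≤ b ∧ 0 < k ∧ ∀ r ∈ Icc c d, k ≤ β r := by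
  obtain ⟨U, hU, htU, hUJ⟩ := mem_nhdsWithin.1 hJ
  -- The time `t` may be an endpoint; the bump is centred at a nearby interior point `w`.
  rw [← closure_Ioo hab.ne] at ht
  obtain ⟨w, hwU, hw⟩ := mem_closure_iff.1 ht U hU htU
  obtain ⟨r, hr, hball⟩ := Metric.isOpen_iff.1 (hU.inter isOpen_Ioo) w ⟨hwU, hw⟩
  let f : ContDiffBump w := ⟨r / 4, r / 2, by positivity, by linarith⟩
  have hf : ∀ x, x ∉ U ∩ Ioo a b → f.normed MeasureTheory.volume x = 0 := by
    intro x hx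
    by_contra h
    have h1 : x ∈ Function.support (f.normed MeasureTheory.volume) := h
    rw [f.support_normed_eq] at h1
    exact hx (hball (Metric.ball_subset_ball (by change r / 2 ≤ r; linarith) h1))
  refine ⟨f.normed MeasureTheory.volume, f.contDiff_normed, f.nonneg_normed,
    fun x hx => hf x fun h => hx ⟨hUJ ⟨h.1, Ioo_subset_Icc_self h.2⟩, Ioo_subset_Icc_self h.2⟩, ?_,
    w - r / 4, w + r / 4, 1 / ∫ x, f x, ?_, by linarith, ?_, ?_, ?_⟩
  · rw [intervalIntegral.integral_eq_integral_of_support_subset, f.integral_normed]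
    intro x hx
    by_contra h
    exact hx (hf x fun h' => h (Ioo_subset_Ioc_self h'.2))
  · have : w - r / 4 ∈ Metric.ball w r := by
      rw [Real.ball_eq_Ioo]; constructor <;> linarith
    exact (hball this).2.1.le
  · have : w + r / 4 ∈ Metric.ball w r := by
      rw [Real.ball_eq_Ioo]; constructor <;> linarith
    exact (hball this).2.2.le
  · exact one_div_pos.2 f.integral_pos
  · intro x hx
    rw [f.normed_def, f.one_of_mem_closedBall]
    rw [Real.closedBall_eq_Icc]
    exact hx

lemma exists_primitive {β : ℝ → ℝ} (hβ : ContDiff ℝ ∞ β) (a : ℝ) :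
    ∃ θ : ℝ → ℝ, ContDiff ℝ ∞ θ ∧ θ a = 0 ∧ (∀ b, θ b = ∫ r in a..b, β r) ∧ deriv θ = β := by
  have h1 : ∀ t, HasDerivAt (fun t => ∫ r in a..t, β r) (β t) t := fun t =>
    (hβ.continuous.integral_hasStrictDerivAt a t).hasDerivAt
  have h2 : deriv (fun t => ∫ r in a..t, β r) = β := funext fun t => (h1 t).deriv
  refine ⟨fun t => ∫ r in a..t, β r, contDiff_infty_iff_deriv.2
    ⟨fun t => (h1 t).differentiableAt, ?_⟩, intervalIntegral.integral_same, fun _ => rfl, h2⟩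
  rwa [h2]

lemma maxset_neg {M : Type*} (f : M → ℝ) : maxset (fun x => -f x) = minset f := by
  ext x
  simp [maxset, minset]

lemma minset_neg {M : Type*} (f : M → ℝ) : minset (fun x => -f x) = maxset f := by
  ext x
  simp [maxset, minset]

variable {E : Type*} [NormedAddCommGroup E] [NormedSpace ℝ E] [FiniteDimensional ℝ E]
  {M : Type*} [TopologicalSpace M] [ChartedSpace E M] [IsManifold 𝓘(ℝ, E) ∞ M]
  [T2Space M] [SecondCountableTopology M]

/-- If `H` has no fixed minimum then some first variation, in the sense of `exists_isDeformation`,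
is at least as large on minima as on maxima, and strictly larger over some interval. -/
theorem exists_variation_of_forall_notMem_minset {a b : ℝ} (hab : a < b) {H : ℝ → M → ℝ}
    (hH : ContinuousOn (fun z : ℝ × M => H z.1 z.2) (Icc a b ×ˢ univ)) {K₀ : Set M}
    (hK₀ : IsCompact K₀) (hHK : ∀ t ∈ Icc a b, Function.support (H t) ⊆ K₀)
    (hmin : ∀ x, ∃ t ∈ Icc a b, x ∉ minset (H t)) [Nonempty M] :
    ∃ (F : Finset M) (ρ : M → M → ℝ) (θ : M → ℝ → ℝ),
      (∀ i ∈ F, ContMDiff 𝓘(ℝ, E) 𝓘(ℝ, ℝ) ∞ (ρ i)) ∧ (∀ i ∈ F, HasCompactSupport (ρ i)) ∧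
      (∀ i ∈ F, tsupport (ρ i) ⊆ (chartAt E i).source) ∧ (∀ i ∈ F, ContDiff ℝ ∞ (θ i)) ∧
      (∀ i ∈ F, θ i a = 0) ∧ (∀ i ∈ F, θ i b = 0) ∧
      ∃ c d k, a ≤ c ∧ c < d ∧ d ≤ b ∧ 0 < k ∧
        ∀ t ∈ Icc a b, ∀ x ∈ maxset (H t), ∀ y ∈ minset (H t),
          ∑ i ∈ F, deriv (θ i) t * ρ i x ≤ ∑ i ∈ F, deriv (θ i) t * ρ i y ∧
          (t ∈ Icc c d →
            (∑ i ∈ F, deriv (θ i) t * ρ i x) + k ≤ ∑ i ∈ F, deriv (θ i) t * ρ i y) := by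
  have : LocallyCompactSpace M := Manifold.locallyCompact_of_finiteDimensional 𝓘(ℝ, E)
  have hHt : ∀ t ∈ Icc a b, Continuous (H t) := fun t ht => by
    refine continuousOn_univ.1 (hH.comp (f := fun x : M => (t, x))
      (by fun_prop) fun x hx => ⟨ht, trivial⟩)
  -- If possible, `p` lies where every `H t` vanishes, so that sublevels below `H t₀ p` stay in
  -- `K₀`. If `K₀` is everything, any `p` will do.
  obtain ⟨p, hp⟩ : ∃ p : M, p ∉ K₀ ∨ K₀ = univ := by
    by_cases h : K₀ = univ
    · exact ⟨Classical.arbitrary M, Or.inr h⟩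
    · obtain ⟨p, hp⟩ := (ne_univ_iff_exists_notMem K₀).1 h
      exact ⟨p, Or.inl hp⟩
  obtain ⟨t₀, ht₀, hpt⟩ := hmin p
  obtain ⟨y₀, hy₀⟩ : ∃ y, H t₀ y < H t₀ p := by simpa [minset] using hpt
  -- The scale `e` separates minima from maxima. If `H t` is `e`-close to `H t₀`, then `H t₀` is
  -- less than `H t₀ y₀ + 2 * e` at minima of `H t` and more than `H t₀ y₀ + 6 * e` at its maxima.
  -- The thresholds `3 * e` for `N` and `4 * e` for the cover lie between.
  obtain ⟨e, he, hv⟩ : ∃ e, 0 < e ∧ H t₀ p = H t₀ y₀ + 8 * e :=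
    ⟨(H t₀ p - H t₀ y₀) / 8, by linarith, by ring⟩
  -- the values of `H` vary slowly near `t₀`
  have hzero : ∀ t ∈ Icc a b, ∀ x ∉ K₀, H t x = 0 := fun t ht x hx => by
    by_contra h
    exact hx (hHK t ht h)
  obtain ⟨J₀, hJ₀, hnear⟩ : ∃ J ∈ 𝓝[Icc a b] t₀, ∀ t ∈ J ∩ Icc a b, ∀ x,
      |H t x - H t₀ x| < e := by
    have h1 : ∀ x ∈ K₀, ∀ᶠ z in 𝓝 (t₀, x), z.1 ∈ Icc a b → |H z.1 z.2 - H t₀ z.2| < e := by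
      intro x _
      have h2 : ContinuousWithinAt (fun z : ℝ × M => |H z.1 z.2 - H t₀ z.2|) (Icc a b ×ˢ univ)
          (t₀, x) := ((hH (t₀, x) ⟨ht₀, trivial⟩).sub
            ((hHt t₀ ht₀).comp continuous_snd).continuousWithinAt).abs
      have h3 := h2.eventually (Iio_mem_nhds (show |H t₀ x - H t₀ x| < e by simpa using he))
      filter_upwards [eventually_nhdsWithin_iff.1 h3] with z hz hz1
      exact hz ⟨hz1, trivial⟩
    have h4 := hK₀.eventually_forall_of_forall_eventually
      (P := fun t x => t ∈ Icc a b → |H t x - H t₀ x| < e) h1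
    refine ⟨_, nhdsWithin_le_nhds h4, fun t ht x => ?_⟩
    by_cases hx : x ∈ K₀
    · exact ht.1 x hx ht.2
    · rw [hzero t ht.2 x hx, hzero t₀ ht₀ x hx]
      simpa using he
  set N : Set M := {x | H t₀ x ≤ H t₀ y₀ + 3 * e}
  have hNcl : IsClosed N := isClosed_le (hHt t₀ ht₀) continuous_const
  have hN : IsCompact N := by
    refine hK₀.of_isClosed_subset hNcl fun x hx => ?_
    rcases hp with hp | hp
    · by_contra h
      have h1 : H t₀ x ≤ H t₀ y₀ + 3 * e := hx
      have h2 := hzero t₀ ht₀ x h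
      have h3 := hzero t₀ ht₀ p hp
      linarith
    · simp [hp]
  -- Failing to be a minimum is witnessed by one strict inequality, so it persists for nearby points
  -- and times.
  have hcov : ∀ x : M, x ∈ N → ∃ U : Set M, ∃ t ∈ Icc a b, ∃ J ∈ 𝓝[Icc a b] t,
      IsOpen U ∧ x ∈ U ∧ U ⊆ (chartAt E x).source ∧ (∃ C, IsCompact C ∧ U ⊆ C) ∧
      (∀ y ∈ U, H t₀ y < H t₀ y₀ + 4 * e) ∧ ∀ r ∈ J ∩ Icc a b, ∀ y ∈ U, y ∉ minset (H r) := by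
    intro x hx
    obtain ⟨t, ht, hxt⟩ := hmin x
    obtain ⟨y, hy⟩ : ∃ y, H t y < H t x := by simpa [minset] using hxt
    have h1 : ContinuousWithinAt (fun z : ℝ × M => H z.1 z.2 - H z.1 y) (Icc a b ×ˢ univ)
        (t, x) := (hH (t, x) ⟨ht, trivial⟩).sub (ContinuousWithinAt.comp (x := (t, x))
          (f := fun z : ℝ × M => (z.1, y)) (t := Icc a b ×ˢ univ) (hH (t, y) ⟨ht, trivial⟩)
          (by fun_prop) fun z hz => ⟨hz.1, trivial⟩)
    have h2 := h1.eventually (Ioi_mem_nhds (show 0 < H t x - H t y by linarith))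
    rw [nhdsWithin_prod_eq, nhdsWithin_univ] at h2
    obtain ⟨J, hJ, V, hV, hJV⟩ := mem_prod_iff.1 h2
    obtain ⟨C, hC, hxC⟩ := exists_compact_mem_nhds x
    have h3 : ∀ᶠ z in 𝓝 x, H t₀ z < H t₀ y₀ + 4 * e :=
      (hHt t₀ ht₀).continuousAt.eventually_lt_const (lt_of_le_of_lt hx (by linarith))
    have h4 := inter_mem (inter_mem hV hxC)
      (inter_mem h3 ((chartAt E x).open_source.mem_nhds (mem_chart_source E x)))
    obtain ⟨U, hUs, hU, hxU⟩ := mem_nhds_iff.1 h4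
    refine ⟨U, t, ht, J, hJ, hU, hxU, fun z hz => (hUs hz).2.2, ⟨C, hC, fun z hz => (hUs hz).1.2⟩,
      fun z hz => (hUs hz).2.1, fun r hr z hz hzm => ?_⟩
    have h5 : 0 < H r z - H r y := @hJV (r, z) ⟨hr.1, (hUs hz).1.1⟩
    have h6 := hzm y
    linarith
  choose! U τ hτ J hJ hU hxU hUch hUC hUlt hUmin using hcov
  choose! C hC hUC using hUC
  obtain ⟨F, hFN, hNF⟩ := hN.elim_nhds_subcover U fun x hx => (hU x hx).mem_nhds (hxU x hx)
  have hbump := fun x (hx : x ∈ N) => exists_normed_bump hab (hτ x hx) (hJ x hx)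
  choose! β hβ hβ0 hβJ hβint hβ' using hbump
  clear hβ'
  obtain ⟨β₀, hβ₀, hβ₀0, hβ₀J, hβ₀int, c, d, k, hc, hcd, hd, hk, hβ₀k⟩ :=
    exists_normed_bump hab ht₀ hJ₀
  obtain ⟨f, hf⟩ := SmoothPartitionOfUnity.exists_isSubordinate 𝓘(ℝ, E) hNcl
    (fun i : F => U i) (fun i => hU _ (hFN i i.2)) (by
      intro x hx
      obtain ⟨i, hi, hxi⟩ := mem_iUnion₂.1 (hNF hx)
      exact mem_iUnion.2 ⟨⟨i, hi⟩, hxi⟩)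
  -- Both bumps have mass one, so the primitive of their difference vanishes at `b` as well as at
  -- `a`.
  have hθ := fun x (hx : x ∈ N) => exists_primitive (hβ₀.sub (hβ x hx)) a
  choose! θ hθ hθa hθint hθd using hθ
  obtain ⟨ρ, hρ⟩ : ∃ ρ : M → M → ℝ, ∀ i (hi : i ∈ F), ρ i = f ⟨i, hi⟩ := by
    classical
    exact ⟨fun i => if hi : i ∈ F then f ⟨i, hi⟩ else 0, fun i hi => dif_pos hi⟩
  have hρU : ∀ i ∈ F, tsupport (ρ i) ⊆ U i := fun i hi => by
    rw [hρ i hi]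
    exact hf ⟨i, hi⟩
  have hρ0 : ∀ i ∈ F, ∀ x, 0 ≤ ρ i x := fun i hi x => by
    rw [hρ i hi]
    exact f.nonneg _ x
  have hρz : ∀ i ∈ F, ∀ x ∉ U i, ρ i x = 0 := fun i hi x hx =>
    image_eq_zero_of_notMem_tsupport fun h => hx (hρU i hi h)
  have hsum : ∀ x, ∑ i ∈ F, ρ i x = ∑ᶠ i, f i x := fun x => by
    rw [finsum_eq_sum_of_fintype, ← Finset.sum_coe_sort F]
    exact Finset.sum_congr rfl fun i _ => by rw [hρ i i.2]
  have hd' : ∀ t x, ∑ i ∈ F, deriv (θ i) t * ρ i x =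
      β₀ t * ∑ i ∈ F, ρ i x - ∑ i ∈ F, β i t * ρ i x := fun t x => by
    rw [Finset.mul_sum, ← Finset.sum_sub_distrib]
    refine Finset.sum_congr rfl fun i hi => ?_
    rw [hθd i (hFN i hi)]
    ring
  refine ⟨F, ρ, θ, fun i hi => ?_, fun i hi => ?_, fun i hi => (hρU i hi).trans (hUch i (hFN i hi)),
    fun i hi => hθ i (hFN i hi), fun i hi => hθa i (hFN i hi), fun i hi => ?_, c, d, k, hc, hcd, hd,
    hk, fun t ht x hx y hy => ?_⟩
  · rw [hρ i hi]
    exact (f ⟨i, hi⟩).contMDiff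
  · exact (hC i (hFN i hi)).of_isClosed_subset (isClosed_tsupport _)
      ((hρU i hi).trans (hUC i (hFN i hi)))
  · rw [hθint i (hFN i hi), intervalIntegral.integral_sub (hβ₀.continuous.intervalIntegrable _ _)
      ((hβ i (hFN i hi)).continuous.intervalIntegrable _ _), hβ₀int, hβint i (hFN i hi), sub_self]
  -- At a minimum no compensating term contributes, since `U i` contains no minima at the times
  -- where `β i` is nonzero. Where `β₀` is nonzero the minima lie in `N`, and there the partition
  -- sums to one.
  have hy' : ∑ i ∈ F, deriv (θ i) t * ρ i y = β₀ t := by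
    have h1 : ∑ i ∈ F, β i t * ρ i y = 0 := Finset.sum_eq_zero fun i hi => by
      by_cases h2 : t ∈ J i ∩ Icc a b
      · rw [hρz i hi y fun h => hUmin i (hFN i hi) t h2 y h hy, mul_zero]
      · rw [hβJ i (hFN i hi) t h2, zero_mul]
    rw [hd', h1, sub_zero]
    by_cases h2 : t ∈ J₀ ∩ Icc a b
    · have h3 : y ∈ N := by
        have h4 := (abs_lt.1 (hnear t h2 y)).1
        have h5 := (abs_lt.1 (hnear t h2 y₀)).2
        have h6 := hy y₀
        change H t₀ y ≤ H t₀ y₀ + 3 * e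
        linarith
      rw [hsum, f.sum_eq_one h3, mul_one]
    · rw [hβ₀J t h2, zero_mul]
  have hle : ∑ i ∈ F, deriv (θ i) t * ρ i x ≤ β₀ t := by
    have h1 : 0 ≤ ∑ i ∈ F, β i t * ρ i x := Finset.sum_nonneg fun i hi =>
      mul_nonneg (hβ0 i (hFN i hi) t) (hρ0 i hi x)
    have h2 : β₀ t * ∑ i ∈ F, ρ i x ≤ β₀ t * 1 :=
      mul_le_mul_of_nonneg_left (by rw [hsum]; exact f.sum_le_one x) (hβ₀0 t)
    rw [hd']
    linarith
  rw [hy']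
  refine ⟨hle, fun htcd => ?_⟩
  have h2 : t ∈ J₀ ∩ Icc a b := by
    by_contra h
    have := hβ₀k t htcd
    rw [hβ₀J t h] at this
    linarith
  -- At times near `t₀` the maxima lie above the `4 * e` threshold, off the whole cover, so the
  -- variation vanishes there.
  have h3 : ∀ i ∈ F, ρ i x = 0 := fun i hi => hρz i hi x fun h => by
    have h4 := hUlt i (hFN i hi) x h
    have h5 := (abs_lt.1 (hnear t h2 x)).2
    have h6 := (abs_lt.1 (hnear t h2 p)).1
    have h7 := hx p
    linarith
  rw [Finset.sum_eq_zero fun i hi => by rw [h3 i hi, mul_zero], zero_add]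
  exact hβ₀k t htcd

end

/-! ### First-order estimate of the Hofer length -/

section

/-- If `D ≥ 0` and `Q₀ < ε` on the zero set of `D` in a compact set, then `s Q_s ≤ D + ε s` there
for small `s > 0`. -/
lemma eventually_forall_mul_le {Z : Type*} [TopologicalSpace Z] {C : Set Z} (hC : IsCompact C)
    {D : Z → ℝ} (hD : ContinuousOn D C) (hD0 : ∀ z ∈ C, 0 ≤ D z) {Q : ℝ → Z → ℝ}
    (hQ : Continuous (Function.uncurry Q)) {ε : ℝ} (h : ∀ z ∈ C, D z = 0 → Q 0 z < ε) :
    ∀ᶠ s in 𝓝[>] (0 : ℝ), ∀ z ∈ C, s * Q s z ≤ D z + s * ε := by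
  have h1 : ∀ z ∈ C, ∀ᶠ y in 𝓝 ((0 : ℝ), z), 0 < y.1 → y.2 ∈ C →
      y.1 * Q y.1 y.2 ≤ D y.2 + y.1 * ε := by
    intro z hz
    -- Near a zero of `D` the bound `Q < ε` persists; where `D` is positive, it dominates the terms
    -- of order `s`.
    rcases (hD0 z hz).eq_or_lt with h0 | h0
    · have h2 : ∀ᶠ y in 𝓝 ((0 : ℝ), z), Q y.1 y.2 < ε :=
        hQ.continuousAt.eventually_lt_const (h z hz h0.symm)
      filter_upwards [h2] with y hy hy0 hyC
      have := mul_le_mul_of_nonneg_left hy.le hy0.le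
      linarith [hD0 _ hyC]
    · have h2 : ContinuousWithinAt (fun y : ℝ × Z => y.1 * Q y.1 y.2 - y.1 * ε - D y.2)
          (univ ×ˢ C) (0, z) := by
        refine ContinuousWithinAt.sub ?_ (ContinuousWithinAt.comp (x := ((0 : ℝ), z)) (t := C)
          (hD z hz) continuousWithinAt_snd fun y hy => hy.2)
        exact ((continuous_fst.mul hQ).sub (continuous_fst.mul continuous_const)).continuousWithinAt
      have h3 := h2.eventually (Iio_mem_nhds (show (0 : ℝ) * Q 0 z - 0 * ε - D z < 0 by linarith))
      filter_upwards [eventually_nhdsWithin_iff.1 h3] with y hy _ hyC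
      have h4 : y.1 * Q y.1 y.2 - y.1 * ε - D y.2 < 0 := hy ⟨trivial, hyC⟩
      linarith
  have h2 := hC.eventually_forall_of_forall_eventually
    (P := fun s z => 0 < s → z ∈ C → s * Q s z ≤ D z + s * ε) h1
  filter_upwards [nhdsWithin_le_nhds h2, self_mem_nhdsWithin] with s hs hs0 z hz
  exact hs z hz hs0 hz

variable {M : Type*}

lemma totVar_eq {f : M → ℝ} {x y : M} (hx : x ∈ maxset f) (hy : y ∈ minset f) :
    totVar f = f x - f y := by
  have : Nonempty M := ⟨x⟩
  have h1 : ⨆ z, f z = f x :=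
    le_antisymm (ciSup_le hx) (le_ciSup (f := f) ⟨f x, by rintro _ ⟨z, rfl⟩; exact hx z⟩ x)
  have h2 : ⨅ z, f z = f y :=
    le_antisymm (ciInf_le (f := f) ⟨f y, by rintro _ ⟨z, rfl⟩; exact hy z⟩ y) (le_ciInf hy)
  rw [totVar, h1, h2]

lemma totVar_comp {f : M → ℝ} {g : M → M} (hg : Function.Surjective g) :
    totVar (fun x => f (g x)) = totVar f := by
  rw [totVar, totVar, hg.iSup_comp, hg.iInf_comp]

variable [TopologicalSpace M]

/-- Functions with support in a given compact set take all their values on another one. -/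
lemma exists_compact_retraction [Nonempty M] {K : Set M} (hK : IsCompact K) :
    ∃ C, IsCompact C ∧ ∃ r : M → M, (∀ x, r x ∈ C) ∧
      ∀ f : M → ℝ, Function.support f ⊆ K → ∀ x, f (r x) = f x := by
  classical
  by_cases h : K = univ
  · exact ⟨K, hK, id, fun x => h ▸ mem_univ x, fun _ _ _ => rfl⟩
  · obtain ⟨p, hp⟩ := (ne_univ_iff_exists_notMem K).1 h
    -- One point `p` outside `K` represents the whole complement, on which the functions vanish.
    refine ⟨insert p K, hK.insert p, fun x => if x ∈ K then x else p, fun x => ?_,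
      fun f hf x => ?_⟩
    · by_cases hx : x ∈ K <;> simp [hx]
    · have hf0 : ∀ y ∉ K, f y = 0 := fun y hy => by
        by_contra h'
        exact hy (hf h')
      by_cases hx : x ∈ K
      · simp [hx]
      · simp [hx, hf0 x hx, hf0 p hp]

lemma exists_mem_maxset [Nonempty M] {f : M → ℝ} (hf : Continuous f) {K : Set M} (hK : IsCompact K)
    (hfK : Function.support f ⊆ K) : (maxset f).Nonempty := by
  obtain ⟨C, hC, r, hr, hrf⟩ := exists_compact_retraction hK
  obtain ⟨x, -, hx⟩ := hC.exists_isMaxOn ⟨_, hr (Classical.arbitrary M)⟩ hf.continuousOn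
  refine ⟨x, fun y => ?_⟩
  rw [← hrf f hfK y]
  exact hx (hr y)

lemma exists_mem_minset [Nonempty M] {f : M → ℝ} (hf : Continuous f) {K : Set M} (hK : IsCompact K)
    (hfK : Function.support f ⊆ K) : (minset f).Nonempty := by
  rw [← maxset_neg]
  exact exists_mem_maxset hf.neg hK (by rwa [Function.support_fun_neg])

lemma continuousOn_totVar [Nonempty M] {H : ℝ → M → ℝ} {I : Set ℝ}
    (hH : ContinuousOn (fun z : ℝ × M => H z.1 z.2) (I ×ˢ univ)) {K : Set M}
    (hK : IsCompact K) (hHK : ∀ t ∈ I, Function.support (H t) ⊆ K) :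
    ContinuousOn (fun t => totVar (H t)) I := by
  obtain ⟨C, hC, r, hr, hrf⟩ := exists_compact_retraction hK
  rw [continuousOn_iff_continuous_domRestrict]
  have h1 : Continuous (Function.uncurry fun (t : I) x => H t x) :=
    continuousOn_univ.1 (hH.comp (f := fun z : I × M => ((z.1 : ℝ), z.2)) (by fun_prop)
      fun z _ => ⟨z.1.2, trivial⟩)
  have h2 := (hC.continuous_sSup (f := fun (t : I) x => H t x) h1).sub (hC.continuous_sInf (f := fun (t : I) x => H t x) h1)
  refine h2.congr fun t => ?_
  have h3 : H t '' C = range (H t) := by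
    refine (image_subset_range _ _).antisymm ?_
    rintro _ ⟨x, rfl⟩
    exact ⟨r x, hr x, hrf _ (hHK t t.2) x⟩
  change sSup (H t '' C) - sInf (H t '' C) = sSup (range (H t)) - sInf (range (H t))
  rw [h3]

variable {E : Type*} [NormedAddCommGroup E] [NormedSpace ℝ E] [ChartedSpace E M]
  {Ω : SymplecticForm E M} {a b : ℝ}

lemma HamPath.continuousOn_totVar [Nonempty M] (γ : HamPath Ω (Icc a b)) :
    ContinuousOn (fun t => totVar (γ.H t)) (Icc a b) := by
  obtain ⟨K, hK, hKs⟩ := γ.isotopy.compact_support (Icc a b) Subset.rfl isCompact_Icc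
  exact Hofer.continuousOn_totVar γ.isotopy.smooth_ham.continuousOn hK hKs

/-- A bound for the variation of the Hamiltonians of a deformation by the first variation. -/
lemma IsDeformation.eventually_totVar_le [Nonempty M] {γ : HamPath Ω (Icc a b)} {G : ℝ → M → ℝ}
    {Γ : ℝ → HamPath Ω (Icc a b)} {χ : ℝ → ℝ → M → M} {R : ℝ → ℝ → M → ℝ}
    (h : IsDeformation γ G Γ χ R) {c d ε : ℝ} (hcd : Icc c d ⊆ Icc a b)
    (hG : ∀ t ∈ Icc c d, ∀ x ∈ maxset (γ.H t), ∀ y ∈ minset (γ.H t), G t x < G t y + ε) :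
    ∀ᶠ s in 𝓝[>] (0 : ℝ), ∀ t ∈ Icc c d, totVar ((Γ s).H t) ≤ totVar (γ.H t) + s * ε := by
  obtain ⟨K, hK, hKs⟩ := γ.isotopy.compact_support (Icc a b) Subset.rfl isCompact_Icc
  obtain ⟨K', hK', hKs'⟩ := h.R_support
  obtain ⟨C, hC, r, hr, hrf⟩ := exists_compact_retraction (hK.union hK')
  have hcont : ∀ t ∈ Icc a b, Continuous (γ.H t) := fun t ht =>
    continuousOn_univ.1 (γ.isotopy.smooth_ham.continuousOn.comp (f := fun x : M => (t, x))
      (by fun_prop) fun x _ => ⟨ht, trivial⟩)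
  -- The deficit of the pair `(x, y)` from the full variation is nonnegative and can vanish only if
  -- `x` is a maximum and `y` a minimum. It plays the part of `D` in `eventually_forall_mul_le`,
  -- with `Q = R(x) - R(y)`.
  have hD0 : ∀ t ∈ Icc a b, ∀ x y, 0 ≤ totVar (γ.H t) - γ.H t x + γ.H t y ∧
      (totVar (γ.H t) - γ.H t x + γ.H t y = 0 → x ∈ maxset (γ.H t) ∧ y ∈ minset (γ.H t)) := by
    intro t ht x y
    obtain ⟨x', hx'⟩ := exists_mem_maxset (hcont t ht) hK (hKs t ht)
    obtain ⟨y', hy'⟩ := exists_mem_minset (hcont t ht) hK (hKs t ht)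
    have h1 := hx' x
    have h2 := hy' y
    rw [totVar_eq hx' hy']
    exact ⟨by linarith, fun h0 => ⟨fun z => (hx' z).trans (by linarith),
      fun z => le_trans (by linarith) (hy' z)⟩⟩
  have hDc : ContinuousOn (fun z : ℝ × M × M => totVar (γ.H z.1) - γ.H z.1 z.2.1 + γ.H z.1 z.2.2)
      (Icc c d ×ˢ (C ×ˢ C)) := by
    have h1 := γ.isotopy.smooth_ham.continuousOn
    refine ((γ.continuousOn_totVar.comp continuousOn_fst fun z hz => hcd hz.1).sub
      (h1.comp (f := fun z : ℝ × M × M => (z.1, z.2.1)) (by fun_prop)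
        fun z hz => ⟨hcd hz.1, trivial⟩)).add
      (h1.comp (f := fun z : ℝ × M × M => (z.1, z.2.2)) (by fun_prop)
        fun z hz => ⟨hcd hz.1, trivial⟩)
  have hQ : Continuous (Function.uncurry fun (s : ℝ) (z : ℝ × M × M) =>
      R s z.1 z.2.1 - R s z.1 z.2.2) :=
    (h.R_continuous.comp (f := fun y : ℝ × ℝ × M × M => (y.1, (y.2.1, y.2.2.1)))
      (by fun_prop)).sub
    (h.R_continuous.comp (f := fun y : ℝ × ℝ × M × M => (y.1, (y.2.1, y.2.2.2))) (by fun_prop))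
  have hev := eventually_forall_mul_le (isCompact_Icc.prod (hC.prod hC)) hDc
    (fun z hz => (hD0 z.1 (hcd hz.1) _ _).1) hQ (ε := ε) (by
      intro z hz h0
      obtain ⟨h1, h2⟩ := (hD0 z.1 (hcd hz.1) _ _).2 h0
      have h3 := hG z.1 hz.1 _ h1 _ h2
      rw [h.R_zero, h.R_zero]
      linarith)
  filter_upwards [hev] with s hs t ht
  -- The coordinate change `χ` is surjective, so it leaves supremum and infimum unchanged.
  have h1 : totVar ((Γ s).H t) = totVar fun x => γ.H t x + s * R s t x := by
    rw [← totVar_comp (h.χ_surjective s t)]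
    exact congrArg _ (funext fun x => h.ham s t (hcd ht) x)
  have hR : Function.support (R s t) ⊆ K' := fun x hx => by
    by_contra h'
    exact hx (hKs' s t x h')
  have hsupp : Function.support (fun x => γ.H t x + s * R s t x) ⊆ K ∪ K' := by
    intro x hx
    by_contra h'
    refine hx ?_
    have h2 : γ.H t x = 0 := by
      by_contra h3
      exact h' (Or.inl (hKs t (hcd ht) h3))
    simp [h2, hKs' s t x fun h3 => h' (Or.inr h3)]
  have hc : Continuous fun x => γ.H t x + s * R s t x :=
    (hcont t (hcd ht)).add (continuous_const.mul (h.R_continuous.comp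
      (f := fun x : M => (s, (t, x))) (by fun_prop)))
  obtain ⟨x, hx⟩ := exists_mem_maxset hc (hK.union hK') hsupp
  obtain ⟨y, hy⟩ := exists_mem_minset hc (hK.union hK') hsupp
  have h2 := hs (t, (r x, r y)) ⟨ht, hr x, hr y⟩
  simp only [hrf _ ((hKs t (hcd ht)).trans subset_union_left),
    hrf _ (hR.trans subset_union_right)] at h2
  rw [h1, totVar_eq hx hy]
  linarith

/-- A deformation whose first variation is at least as large on minima as on maxima, and strictly
larger over some interval, decreases the length. -/
theorem IsDeformation.eventually_length_lt [Nonempty M] {γ : HamPath Ω (Icc a b)} {G : ℝ → M → ℝ}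
    {Γ : ℝ → HamPath Ω (Icc a b)} {χ : ℝ → ℝ → M → M} {R : ℝ → ℝ → M → ℝ}
    (h : IsDeformation γ G Γ χ R) {c d k : ℝ} (hac : a ≤ c) (hcd : c < d) (hdb : d ≤ b) (hk : 0 < k)
    (hG : ∀ t ∈ Icc a b, ∀ x ∈ maxset (γ.H t), ∀ y ∈ minset (γ.H t),
      G t x ≤ G t y ∧ (t ∈ Icc c d → G t x + k ≤ G t y)) :
    ∀ᶠ s in 𝓝[>] (0 : ℝ), (Γ s).length < γ.length := by
  have hsub : Icc c d ⊆ Icc a b := Icc_subset_Icc hac hdb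
  -- The possible increase outside `[c, d]` is at most `s * ε * (b - a) = s * k * (d - c) / 4`, less
  -- than the gain `s * k * (d - c) / 2` inside.
  set ε := k * (d - c) / (4 * (b - a)) with hεdef
  have hε : 0 < ε := div_pos (mul_pos hk (by linarith)) (by linarith)
  have hε' : ε * (b - a) = k * (d - c) / 4 := by
    rw [hεdef]
    field_simp [show b - a ≠ 0 by linarith]
  have h1 := h.eventually_totVar_le (c := a) (d := b) (ε := ε) Subset.rfl fun t ht x hx y hy => by
    linarith [(hG t ht x hx y hy).1]
  have h2 := h.eventually_totVar_le (c := c) (d := d) (ε := -(k / 2)) hsub fun t ht x hx y hy => by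
    linarith [(hG t (hsub ht) x hx y hy).2 ht]
  filter_upwards [h1, h2, self_mem_nhdsWithin] with s hs1 hs2 hs0
  have hs0 : 0 < s := hs0
  have hint : ∀ (η : HamPath Ω (Icc a b)) {u v : ℝ}, a ≤ u → u ≤ v → v ≤ b →
      IntervalIntegrable (fun t => totVar (η.H t)) MeasureTheory.volume u v :=
    fun η u v hu huv hv => ContinuousOn.intervalIntegrable (η.continuousOn_totVar.mono (by
      rw [uIcc_of_le huv]
      exact Icc_subset_Icc hu hv))
  have hsplit : ∀ η : HamPath Ω (Icc a b), η.length = (∫ t in a..c, totVar (η.H t)) +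
      (∫ t in c..d, totVar (η.H t)) + ∫ t in d..b, totVar (η.H t) := fun η => by
    rw [intervalIntegral.integral_add_adjacent_intervals (hint η le_rfl hac (by linarith))
      (hint η hac hcd.le hdb), intervalIntegral.integral_add_adjacent_intervals
      (hint η le_rfl (by linarith) hdb) (hint η (by linarith) hdb le_rfl), HamPath.length]
  have hle : ∀ {u v e : ℝ}, a ≤ u → u ≤ v → v ≤ b →
      (∀ t ∈ Icc u v, totVar ((Γ s).H t) ≤ totVar (γ.H t) + s * e) →
      ∫ t in u..v, totVar ((Γ s).H t) ≤ (∫ t in u..v, totVar (γ.H t)) + (v - u) * (s * e) := by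
    intro u v e hu huv hv hb
    have h3 := intervalIntegral.integral_mono_on huv (hint (Γ s) hu huv hv)
      ((hint γ hu huv hv).add intervalIntegrable_const) hb
    rwa [intervalIntegral.integral_add (hint γ hu huv hv) intervalIntegrable_const,
      intervalIntegral.integral_const, smul_eq_mul] at h3
  have h3 := hle le_rfl hac (by linarith) fun t ht => hs1 t ⟨ht.1, by linarith [ht.2]⟩
  have h4 := hle hac hcd.le hdb hs2
  have h5 := hle (by linarith) hdb le_rfl fun t ht => hs1 t ⟨by linarith [ht.1], ht.2⟩
  rw [hsplit (Γ s), hsplit γ]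
  have h6 : (c - a) * (s * ε) + (d - c) * (s * -(k / 2)) + (b - d) * (s * ε) < 0 := by
    have h7 : (c - a) * (s * ε) + (d - c) * (s * -(k / 2)) + (b - d) * (s * ε) =
        s * (ε * (b - a) - (d - c) * ε - k * (d - c) / 2) := by ring
    rw [h7, hε']
    refine mul_neg_of_pos_of_neg hs0 ?_
    have h8 := mul_pos (sub_pos.2 hcd) hε
    have h9 := mul_pos hk (sub_pos.2 hcd)
    linarith
  linarith

end

/-! ### Shortening paths and local minima -/

section

variable {E : Type*} [NormedAddCommGroup E] [NormedSpace ℝ E] [FiniteDimensional ℝ E]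
  {M : Type*} [TopologicalSpace M] [ChartedSpace E M] [IsManifold 𝓘(ℝ, E) ∞ M]
  [T2Space M] [SecondCountableTopology M] [Nonempty M] {Ω : SymplecticForm E M} {a b : ℝ}

/-- A path without fixed minimum or without fixed maximum has a deformation whose first variation
decreases the Hofer length. -/
theorem HamPath.exists_isDeformation_of_not_hasFixed (hab : a < b) (γ : HamPath Ω (Icc a b))
    (h : ¬ (γ.HasFixedMin (Icc a b) ∧ γ.HasFixedMax (Icc a b))) :
    ∃ G Γ χ R, IsDeformation γ G Γ χ R ∧ ∃ c d k, a ≤ c ∧ c < d ∧ d ≤ b ∧ 0 < k ∧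
      ∀ t ∈ Icc a b, ∀ x ∈ maxset (γ.H t), ∀ y ∈ minset (γ.H t),
        G t x ≤ G t y ∧ (t ∈ Icc c d → G t x + k ≤ G t y) := by
  obtain ⟨K, hK, hKs⟩ := γ.isotopy.compact_support (Icc a b) Subset.rfl isCompact_Icc
  have hH := γ.isotopy.smooth_ham.continuousOn
  by_cases hmin : γ.HasFixedMin (Icc a b)
  · have hmax : ∀ x, ∃ t ∈ Icc a b, x ∉ minset fun y => -γ.H t y := by
      intro x
      by_contra! h'
      refine h ⟨hmin, x, mem_iInter₂.2 fun t ht => ?_⟩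
      rw [← minset_neg]
      exact h' t ht
    obtain ⟨F, ρ, θ, hρ, hc, hp, hθ, ha, hb, c, d, k, hac, hcd, hdb, hk, hG⟩ :=
      exists_variation_of_forall_notMem_minset (E := E) hab hH.neg hK
        (fun t ht => by simpa using hKs t ht) hmax
    -- The variation was found for `-H`, where maxima and minima are exchanged; reversing the sign
    -- of `θ` adapts it to `H`.
    obtain ⟨Γ, χ, R, hΓ⟩ := exists_isDeformation γ F ρ id (fun i t => -θ i t) hρ hc hp
      (fun i hi => (hθ i hi).neg) (fun i hi => by simp [ha i hi]) fun i hi => by simp [hb i hi]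
    refine ⟨_, Γ, χ, R, hΓ, c, d, k, hac, hcd, hdb, hk, fun t ht x hx y hy => ?_⟩
    rw [← minset_neg] at hx
    rw [← maxset_neg] at hy
    obtain ⟨h1, h2⟩ := hG t ht y hy x hx
    simp only [deriv.fun_neg, neg_mul, Finset.sum_neg_distrib]
    exact ⟨by linarith, fun htcd => by linarith [h2 htcd]⟩
  · have hmin' : ∀ x, ∃ t ∈ Icc a b, x ∉ minset (γ.H t) := by
      intro x
      by_contra! h'
      exact hmin ⟨x, mem_iInter₂.2 h'⟩
    obtain ⟨F, ρ, θ, hρ, hc, hp, hθ, ha, hb, c, d, k, hac, hcd, hdb, hk, hG⟩ :=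
      exists_variation_of_forall_notMem_minset (E := E) hab hH hK hKs hmin'
    obtain ⟨Γ, χ, R, hΓ⟩ := exists_isDeformation γ F ρ id θ hρ hc hp hθ ha hb
    exact ⟨_, Γ, χ, R, hΓ, c, d, k, hac, hcd, hdb, hk, hG⟩

/-- A path without fixed minimum or without fixed maximum can be shortened by a deformation with
fixed endpoints. -/
theorem HamPath.exists_shorter_deformation (hab : a < b) (γ : HamPath Ω (Icc a b))
    (h : ¬ (γ.HasFixedMin (Icc a b) ∧ γ.HasFixedMax (Icc a b))) :
    ∃ Γ : ℝ≥0 → HamPath Ω (Icc a b), Continuous Γ ∧ Γ 0 = γ ∧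
      (∀ s, Γ s ∈ HamPath.pathSpace Ω a b (γ.φ a) (γ.φ b)) ∧
      ∀ s, 0 < s → (Γ s).length < γ.length := by
  obtain ⟨G, Γ, χ, R, hΓ, c, d, k, hac, hcd, hdb, hk, hG⟩ :=
    γ.exists_isDeformation_of_not_hasFixed hab h
  obtain ⟨s₀, hs₀, hlt⟩ := mem_nhdsGT_iff_exists_Ioc_subset.1
    (hΓ.eventually_length_lt hac hcd hdb hk hG)
  have hs₀ : 0 < s₀ := hs₀
  -- The length is known to drop only for `0 < s ≤ s₀`, so the deformation is stopped at `s₀`.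
  refine ⟨fun s => Γ (min s s₀), (continuous_hamPath hab hΓ.smooth hΓ.support).comp
    (NNReal.continuous_coe.min continuous_const), ?_, fun s => ⟨hΓ.left _, hΓ.right _⟩,
    fun s hs => hlt ⟨lt_min hs hs₀, min_le_right _ _⟩⟩
  simp [min_eq_left hs₀.le, hΓ.zero]

lemma HamPath.IsLocallyMinimal.hasFixed (hab : a < b) {γ : HamPath Ω (Icc a b)}
    (h : γ.IsLocallyMinimal) : γ.HasFixedMin (Icc a b) ∧ γ.HasFixedMax (Icc a b) := by
  by_contra hγ
  obtain ⟨Γ, hΓ, hΓ0, hmem, hlt⟩ := γ.exists_shorter_deformation hab hγ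
  have h1 : Tendsto Γ (𝓝[>] 0) (𝓝[HamPath.pathSpace Ω a b (γ.φ a) (γ.φ b)] γ) := by
    refine tendsto_nhdsWithin_iff.2 ⟨?_, Eventually.of_forall hmem⟩
    have := hΓ.continuousAt (x := 0)
    rw [ContinuousAt, hΓ0] at this
    exact this.mono_left nhdsWithin_le_nhds
  obtain ⟨s, hs1, hs2⟩ := ((h1.eventually h).and self_mem_nhdsWithin).exists
  exact (hlt s hs2).not_ge hs1

end

end Hofer

end

open Hofer in
theorem mainTheorem1 {E : Type*} [NormedAddCommGroup E] [NormedSpace ℝ E] [FiniteDimensional ℝ E]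
    {M : Type*} [TopologicalSpace M] [ChartedSpace E M] [IsManifold 𝓘(ℝ, E) ∞ M]
    [T2Space M] [SecondCountableTopology M] [ConnectedSpace M] (Ω : SymplecticForm E M) :
    (∀ (I : Set ℝ), I.OrdConnected → ∀ γ : HamPath Ω I, γ.IsGeodesic →
      ∀ s ∈ I, ∃ N ⊆ I, N ∈ 𝓝[I] s ∧ γ.HasFixedMin N ∧ γ.HasFixedMax N) ∧
    (∀ γ : HamPath Ω (Icc 0 1), ¬ (γ.HasFixedMin (Icc 0 1) ∧ γ.HasFixedMax (Icc 0 1)) →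
      ∃ Γ : ℝ≥0 → HamPath Ω (Icc 0 1), Continuous Γ ∧ Γ 0 = γ ∧
        (∀ s, Γ s ∈ HamPath.pathSpace Ω 0 1 (γ.φ 0) (γ.φ 1)) ∧
        ∀ s, 0 < s → (Γ s).length < γ.length) := by
  refine ⟨fun I _ γ hγ s hs => ?_, fun γ hγ => γ.exists_shorter_deformation one_pos hγ⟩
  obtain ⟨a, b, hI, hab, -, hN, hmin⟩ := hγ.2 s hs
  exact ⟨Icc a b, hI, hN, HamPath.IsLocallyMinimal.hasFixed hab hmin⟩
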